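/- Let $T$ be a countable discrete group acting by homeomorphisms on a compact Hausdorff space $(X,\tau_1)$, and suppose that $(X,T)$ is a Veech system: there is a metric $D$ on $X$, with metric topology $\tau_2$, such that $(X,\tau_2)$ is separable, $\tau_1\subseteq\tau_2$, every $\tau_2$-open set is $\tau_1$-Borel, and $D(tx,ty)=D(x,y)$ for all $x,y\in X$, $t\in T$. Then the following hold (topological notions refer to $\tau_1$). 1. For every ergodic $T$-invariant Borel probability measure $\mu$ on $X$, the support of $\mu$ is a minimal set, that is, a nonempty closed invariant set in which every orbit is dense. 2. If $T$ is amenable, then for every minimal set $M\subseteq X$: (a) $(M,T)$ is almost automorphic: there is $x\in M$ such that, for every net $(t_\alpha)$ in $T$ and every $z\in M$, if $t_\alpha x\to z$ then $t_\alpha^{-1}z\to x$; (b) $(M,T)$ is point distal: there is a point of $M$ with dense orbit that is proximal to no other point of $M$, where $x,y$ are proximal if $t_\alpha x$ and $t_\alpha y$ converge to a common point for some net $(t_\alpha)$ in $T$; (c) $(M,T)$ is an isomorphic extension of its maximal equicontinuous factor $\pi:M\to N$: $M$ and $N$ each carry exactly one invariant Borel probability measure, and $\pi$ is an isomorphism modulo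 null sets of the resulting measure-preserving systems. Here the maximal equicontinuous factor is the equicontinuous compact Hausdorff factor of $M$ through which every other such factor map factors. 3. If $T$ is amenable, then every ergodic $T$-invariant Borel probability measure $\mu$ on $X$ has discrete spectrum: the finite-dimensional $T$-invariant subspaces of $L^2(X,\mu)$ together span a dense subspace. -/

import Mathlib

open Filter Topology MeasureTheory

noncomputable section

namespace VeechSystem

universe u v

/-! Throughout, a countable discrete group `T` acts by homeomorphisms on compact Hausdorff spaces. -/

/-- `d` is a metric on `X` whose metric topology `τ₂` is separable, finer than the given topology
`τ₁`, has only `τ₁`-Borel open sets, and such that `T` acts by isometries of `d`. -/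
structure IsVeechMetric (T : Type v) (X : Type u) [τ₁ : TopologicalSpace X] [Group T]
    [MulAction T X] (d : MetricSpace X) : Prop where
  finer : ∀ U : Set X, IsOpen[τ₁] U → IsOpen[d.toUniformSpace.toTopologicalSpace] U
  measurable_of_isOpen : ∀ U : Set X, IsOpen[d.toUniformSpace.toTopologicalSpace] U →
    MeasurableSet[@borel X τ₁] U
  dist_smul : ∀ (t : T) (x y : X), d.dist (t • x) (t • y) = d.dist x y
  separable : @TopologicalSpace.SeparableSpace X d.toUniformSpace.toTopologicalSpace

/-- A topological dynamical system `(X, T)` is a Veech system if it carries a Veech metric. -/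
def IsVeechSystem (T : Type v) (X : Type u) [TopologicalSpace X] [Group T] [MulAction T X] :
    Prop :=
  ∃ d : MetricSpace X, IsVeechMetric T X d

/-- A nonempty closed invariant set in which every orbit is dense. -/
structure IsMinimalSet (T : Type v) {X : Type u} [TopologicalSpace X] [Group T] [MulAction T X]
    (S : Set X) : Prop where
  nonempty : S.Nonempty
  isClosed : IsClosed S
  smul_mem : ∀ (t : T), ∀ x ∈ S, t • x ∈ S
  dense_orbit : ∀ x ∈ S, S ⊆ closure (MulAction.orbit T x)

open scoped Classical in
/-- `F` is a sequence of nonempty finite subsets of `T` with `|t Fₙ ∆ Fₙ| / |Fₙ| → 0` for every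
`t ∈ T`. -/
def IsFolnerSequence {T : Type v} [Group T] (F : ℕ → Finset T) : Prop :=
  (∀ n, (F n).Nonempty) ∧
    ∀ t : T, Tendsto
      (fun n => ((symmDiff ((F n).image (fun s => t * s)) (F n)).card : ℝ) / ((F n).card : ℝ))
      atTop (𝓝 0)

/-- Amenability of a countable discrete group. -/
def IsAmenable (T : Type v) [Group T] : Prop :=
  ∃ F : ℕ → Finset T, IsFolnerSequence F

/-- `x` is an almost automorphic point: whenever `tₐ • x → z` along a net `tₐ` in `T`, then
`tₐ⁻¹ • z → x`. (A net in `T` is replaced by the filter on `T` of its tails.) -/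
def IsAlmostAutomorphicPoint (T : Type v) {M : Type u} [TopologicalSpace M] [Group T]
    [MulAction T M] (x : M) : Prop :=
  ∀ (F : Filter T) (z : M), Tendsto (fun t : T => t • x) F (𝓝 z) →
    Tendsto (fun t : T => t⁻¹ • z) F (𝓝 x)

/-- A minimal system is almost automorphic if it has an almost automorphic point. -/
def IsAlmostAutomorphic (T : Type v) (M : Type u) [TopologicalSpace M] [Group T]
    [MulAction T M] : Prop :=
  MulAction.IsMinimal T M ∧ ∃ x : M, IsAlmostAutomorphicPoint T x

/-- `x` and `y` are proximal: some net `tₐ` in `T` brings both to one point. -/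
def Proximal (T : Type v) {M : Type u} [TopologicalSpace M] [Group T] [MulAction T M]
    (x y : M) : Prop :=
  ∃ (F : Filter T) (z : M), F.NeBot ∧ Tendsto (fun t : T => t • x) F (𝓝 z) ∧
    Tendsto (fun t : T => t • y) F (𝓝 z)

/-- Some point with dense orbit is proximal to no other point. -/
def IsPointDistal (T : Type v) (M : Type u) [TopologicalSpace M] [Group T] [MulAction T M] :
    Prop :=
  ∃ x : M, Dense (MulAction.orbit T x) ∧ ∀ y : M, Proximal T x y → y = x

/-- Factor map of topological dynamical systems. -/
structure IsFactorMap (T : Type v) {M N : Type*} [TopologicalSpace M] [TopologicalSpace N]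
    [Group T] [MulAction T M] [MulAction T N] (π : M → N) : Prop where
  continuous : Continuous π
  surjective : Function.Surjective π
  map_smul : ∀ (t : T) (x : M), π (t • x) = t • π x

/-- The maps `x ↦ t • x`, `t ∈ T`, are equicontinuous. This is used on compact Hausdorff spaces,
where the uniformity is determined by the topology. -/
def IsEquicontinuousSystem (T : Type v) (N : Type u) [UniformSpace N] [Group T]
    [MulAction T N] : Prop :=
  Equicontinuous (fun (t : T) (x : N) => t • x)

/-- `π : M → N` is the maximal equicontinuous factor of `M`: the system `N` is equicontinuous, and
every factor map from `M` to an equicontinuous compact Hausdorff system factors through `π`.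
(Up to isomorphism such a system is a quotient of `M`, so it is enough to look at those in the
universe of `M`.) -/
structure IsMaximalEquicontinuousFactor (T : Type v) {M N : Type u} [TopologicalSpace M]
    [UniformSpace N] [Group T] [MulAction T M] [MulAction T N] (π : M → N) : Prop where
  isFactorMap : IsFactorMap T π
  equicontinuous : IsEquicontinuousSystem T N
  universal : ∀ (N' : Type u) [UniformSpace N'] [CompactSpace N'] [T2Space N'] [MulAction T N']
    [ContinuousConstSMul T N'] (π' : M → N'), IsFactorMap T π' → IsEquicontinuousSystem T N' →
    ∃ ρ : N → N', IsFactorMap T ρ ∧ π' = ρ ∘ π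

/-- There is exactly one invariant probability measure. -/
def IsUniquelyErgodic (T : Type v) (M : Type u) [MeasurableSpace M] [Group T]
    [MulAction T M] : Prop :=
  ∃! μ : Measure M, IsProbabilityMeasure μ ∧ SMulInvariantMeasure T M μ

/-- `π` is an isomorphic extension: a factor map between uniquely ergodic systems that is an
isomorphism of measure preserving systems, that is, it has a measurable inverse modulo null sets
for the invariant measure `μ` of `M` and its image, the invariant measure of `N`. -/
structure IsIsomorphicExtension (T : Type v) {M N : Type u} [TopologicalSpace M]
    [TopologicalSpace N] [MeasurableSpace M] [MeasurableSpace N] [Group T] [MulAction T M]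
    [MulAction T N] (π : M → N) : Prop where
  isFactorMap : IsFactorMap T π
  uniquelyErgodic_source : IsUniquelyErgodic T M
  uniquelyErgodic_target : IsUniquelyErgodic T N
  isomorphism : ∀ μ : Measure M, IsProbabilityMeasure μ → SMulInvariantMeasure T M μ →
    ∃ ψ : N → M, Measurable ψ ∧ (∀ᵐ x ∂μ, ψ (π x) = x) ∧ (∀ᵐ y ∂(μ.map π), π (ψ y) = y)

/-- The maximal equicontinuous factor of `M` exists and `M` is an isomorphic extension of it.
(That factor is unique up to isomorphism.) -/
def IsIsomorphicExtensionOfMaximalEquicontinuousFactor (T : Type v) (M : Type u)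
    [TopologicalSpace M] [MeasurableSpace M] [Group T] [MulAction T M] : Prop :=
  ∃ (N : Type u) (_ : UniformSpace N) (_ : CompactSpace N) (_ : T2Space N)
    (_ : MeasurableSpace N) (_ : BorelSpace N) (_ : MulAction T N) (_ : ContinuousConstSMul T N)
    (π : M → N), IsMaximalEquicontinuousFactor T π ∧ IsIsomorphicExtension T π

/-- The finite-dimensional subspaces of `L²(X, μ)` that are invariant under the unitaries
`U_t f = f (t • ·)`, `t ∈ T`, together span a dense subspace. -/
def HasDiscreteSpectrum (T : Type v) (X : Type u) [MeasurableSpace X] [Group T] [MulAction T X]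
    [MeasurableConstSMul T X] (μ : Measure X) [SMulInvariantMeasure T X μ] : Prop :=
  (⨆ V ∈ {V : Submodule ℂ (Lp ℂ 2 μ) | FiniteDimensional ℂ V ∧
      ∀ (t : T), ∀ f ∈ V, DomMulAct.mk t • f ∈ V}, V).topologicalClosure = ⊤

end VeechSystem

end

/-!
Let `D` be the Veech metric. The system is studied through two topologies with the same Borel sets,
and `E` denotes `X` with the metric topology, `j : E ≃ᵐ X` the identity map.

Points `x` in the `D`-support of an invariant probability measure have a `D`-totally bounded orbit:
translates of a ball around `x` all have the same positive measure, so only finitely many of them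
are disjoint (`totallyBounded_orbit_of_mem_support`). Such points are almost automorphic
(`isAlmostAutomorphicPoint_of_totallyBounded`): if `t x → z` along an ultrafilter, then `t x` is
`D`-Cauchy, hence `D (t⁻¹ s x) x = D (s x) (t x)` is small, and `t⁻¹ z`, the limit of `t⁻¹ s x`, is
close to `x`. If the measure `μ` is ergodic, its `D`-support `S` is the `D`-closure of a single
orbit (`closure_orbit_eq_support`). The support of `μ` is the closure of `S`, and its orbits are
dense, because every point of it is a limit of points `t x` with `x ∈ S`, so that its orbit
accumulates at `x` (`isMinimalSet_support`).

For discrete spectrum, the kernel `max 0 (1 - D x y / ε)` defines a self-adjoint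
operator that commutes with the action, and it is compact since `S` is totally bounded. By the
spectral theorem its range lies in the closed span of the finite-dimensional invariant subspaces
(`apply_mem_closure_finiteDimensionalPart`). The kernel has constant mass on `S`, so that the
normalized operators tend to the identity as `ε → 0` (`hasDiscreteSpectrum_of_isometric`).

Let now `X` be minimal and `T` amenable. Invariant states on `C(X)` exist by averaging over Følner
sets, and an extreme one gives an ergodic measure (`IsAmenable.exists_ergodic_measure`). Let `S` be
its `D`-support and `K` the completion of `S`, a compact metric space with a minimal isometric
action, which has only one invariant probability measure (`invariant_measure_unique_of_isMinimal`);
this measure is carried by `S`, a Borel subset of `K` by the Lusin–Souslin theorem. The closure `Γ`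
of `{(s, s) : s ∈ S}` in `K × X` is the graph of a factor map `π : X → K`
(`exists_isometric_factor`):
* over `s ∈ S ⊆ K` the only point of `Γ` is `(s, s)`, because the metric topology is finer;
* if `(k, x)` and `(k', x)` are in `Γ`, an invariant measure on the triples of this kind with
  the given distance of `k` and `k'` is carried by triples with `k, k' ∈ S`, where `k = k'`.

So `π` is an equicontinuous factor, injective over `S`. Points with the same image are proximal,
as can be seen by moving their image to a point of `S`; hence every equicontinuous factor factors
through `π`, and points of `S` are proximal to no other point. Since `S` has full measure in `K`,
the inverse of `π` over `S` transports the invariant measure of `K` to the only invariant measure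
of `X`.
-/

noncomputable section

namespace VeechSystem

universe u v

/-! ### Isometric actions on metric spaces -/

section Isometric

variable {T : Type*} [Group T] {E : Type*} [MetricSpace E] [MulAction T E] [IsIsometricSMul T E]

theorem dist_inv_smul_smul (s t : T) (x y : E) :
    dist ((t⁻¹ * s) • x) y = dist (s • x) (t • y) := by
  rw [mul_smul, ← dist_smul t, smul_inv_smul]

theorem smul_mem_support {Y : Type*} [TopologicalSpace Y] [MulAction T Y] [ContinuousConstSMul T Y]
    [MeasurableSpace Y] [BorelSpace Y] {m : Measure Y} [SMulInvariantMeasure T Y m] (t : T) {x : Y}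
    (hx : x ∈ m.support) : t • x ∈ m.support := by
  rw [Measure.mem_support_iff_forall] at hx ⊢
  intro U hU
  have := hx _ ((continuous_const_smul t).continuousAt.preimage_mem_nhds hU)
  rwa [measure_preimage_smul] at this

variable [MeasurableSpace E] [BorelSpace E] {m : Measure E}

/-- Translates of a ball have equal measure, so only finitely many of them are disjoint. -/
theorem totallyBounded_orbit_of_mem_support [IsFiniteMeasure m] [SMulInvariantMeasure T E m]
    {x : E} (hx : x ∈ m.support) : TotallyBounded (MulAction.orbit T x) := by
  rw [Metric.totallyBounded_iff]
  intro ε hε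
  by_contra hcon
  push Not at hcon
  -- Otherwise the orbit contains an infinite `ε`-separated sequence.
  have hsymm : Std.Symm fun y z : E => ε ≤ dist y z := ⟨fun y z h => by rwa [dist_comm]⟩
  obtain ⟨f, hf, hr⟩ := exists_seq_of_forall_finset_exists' (fun y => y ∈ MulAction.orbit T x)
    (fun y z : E => ε ≤ dist y z) (by
      intro s _
      obtain ⟨y, hy, hys⟩ := Set.not_subset.1 (hcon s s.finite_toSet)
      refine ⟨y, hy, fun z hz => ?_⟩
      by_contra hlt
      exact hys (Set.mem_biUnion (Finset.mem_coe.2 hz)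
        (by rw [Metric.mem_ball, dist_comm]; exact not_le.1 hlt)))
  have hball : ∀ n, m (Metric.ball (f n) (ε / 2)) = m (Metric.ball x (ε / 2)) := by
    intro n
    obtain ⟨t, ht⟩ := hf n
    have : (t • ·) ⁻¹' Metric.ball (f n) (ε / 2) = Metric.ball x (ε / 2) := by
      ext y
      simp [← ht]
    rw [← this, measure_preimage_smul]
  have hdisj : Pairwise (Function.onFun Disjoint fun n => Metric.ball (f n) (ε / 2)) := by
    intro a b hab
    refine Metric.ball_disjoint_ball ?_
    have : ε ≤ dist (f a) (f b) := hr hab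
    linarith
  have hsum := measure_iUnion (μ := m) hdisj fun n => Metric.isOpen_ball.measurableSet
  have hpos : m (Metric.ball x (ε / 2)) ≠ 0 :=
    ((Measure.mem_support_iff_forall x).1 hx _ (Metric.ball_mem_nhds x (half_pos hε))).ne'
  simp only [hball] at hsum
  rw [ENNReal.tsum_const_eq_top_of_ne_zero hpos] at hsum
  exact measure_ne_top _ _ hsum

/-- An ergodic measure of an isometric action lives on a single orbit closure: the thickenings of
an orbit in the support are invariant of positive measure, hence conull. -/
theorem closure_orbit_eq_support [IsFiniteMeasure m] [ErgodicSMul T E m]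
    {x : E} (hx : x ∈ m.support) : closure (MulAction.orbit T x) = m.support := by
  apply subset_antisymm
  · refine closure_minimal ?_ Measure.isClosed_support
    rintro _ ⟨t, rfl⟩
    exact smul_mem_support t hx
  refine Measure.support_subset_of_isClosed isClosed_closure ?_
  have key : ∀ δ : ℝ, 0 < δ → Metric.thickening δ (MulAction.orbit T x) ∈ ae m := by
    intro δ hδ
    have hinv : ∀ g : T, (g • ·) ⁻¹' Metric.thickening δ (MulAction.orbit T x)
        = Metric.thickening δ (MulAction.orbit T x) := by
      intro g
      ext y
      simp only [Set.mem_preimage, Metric.mem_thickening_iff]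
      constructor
      · rintro ⟨_, ⟨t, rfl⟩, h⟩
        refine ⟨(g⁻¹ * t) • x, ⟨_, rfl⟩, ?_⟩
        rw [dist_comm, dist_inv_smul_smul, dist_comm]
        exact h
      · rintro ⟨_, ⟨t, rfl⟩, h⟩
        refine ⟨(g * t) • x, ⟨_, rfl⟩, ?_⟩
        rw [mul_smul, dist_smul]
        exact h
    have hconst : EventuallyConst (Metric.thickening δ (MulAction.orbit T x)) (ae m) :=
      aeconst_of_forall_preimage_smul_ae_eq T
        Metric.isOpen_thickening.measurableSet.nullMeasurableSet
        (fun g => by rw [hinv g]; exact EventuallyEq.rfl)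
    rcases eventuallyConst_set'.1 hconst with h | h
    · exfalso
      have hpos := (Measure.mem_support_iff_forall x).1 hx _
        (Metric.isOpen_thickening.mem_nhds
          (Metric.self_subset_thickening hδ _ (MulAction.mem_orbit_self (M := T) x)))
      rw [measure_congr h] at hpos
      simp at hpos
    · exact eventuallyEq_univ.1 h
  have hall : ∀ᵐ y ∂m, ∀ n : ℕ,
      y ∈ Metric.thickening (1 / ((n : ℝ) + 1)) (MulAction.orbit T x) :=
    ae_all_iff.2 fun n => key _ Nat.one_div_pos_of_nat
  filter_upwards [hall] with y hy
  rw [Metric.mem_closure_iff]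
  intro ε hε
  obtain ⟨n, hn⟩ := exists_nat_one_div_lt hε
  obtain ⟨z, hz, hd⟩ := Metric.mem_thickening_iff.1 (hy n)
  exact ⟨z, hz, hd.trans hn⟩

end Isometric

section AlmostAutomorphic

variable {T : Type*} [Group T] {E : Type*} [MetricSpace E] [MulAction T E] [IsIsometricSMul T E]
  {X : Type*} [TopologicalSpace X] [RegularSpace X] [MulAction T X] [ContinuousConstSMul T X]

/-- A point is almost automorphic as soon as its orbit is totally bounded for an invariant metric
that is finer than the topology. Along an ultrafilter the orbit is Cauchy for the metric, and
`D (t⁻¹ s x) x = D (s x) (t x)` is then small. -/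
theorem isAlmostAutomorphicPoint_of_totallyBounded {j : E → X} (hj : Continuous j)
    (hjT : ∀ (t : T) (x : E), j (t • x) = t • j x) {x : E}
    (hx : TotallyBounded (MulAction.orbit T x)) : IsAlmostAutomorphicPoint T (j x) := by
  intro F z hz
  -- Along an ultrafilter a totally bounded orbit is Cauchy.
  rw [tendsto_iff_ultrafilter]
  intro G hG
  have hGz : Tendsto (fun t : T => t • j x) G (𝓝 z) := hz.mono_left hG
  have hcauchy : Cauchy ((G.map fun t : T => t • x : Ultrafilter E) : Filter E) := by
    refine totallyBounded_iff_ultrafilter.1 hx _ ?_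
    rw [Ultrafilter.coe_map, le_principal_iff]
    exact Filter.mem_map.2 (univ_mem' fun t => ⟨t, rfl⟩)
  refine (closed_nhds_basis (j x)).tendsto_right_iff.2 ?_
  rintro U ⟨hU, hUc⟩
  obtain ⟨ε, hε, hεU⟩ := Metric.mem_nhds_iff.1 (hj.continuousAt.preimage_mem_nhds hU)
  obtain ⟨A, hA, hAε⟩ := (Metric.cauchy_iff.1 hcauchy).2 ε hε
  have hA' : ∀ᶠ t in (G : Filter T), t • x ∈ A := hA
  filter_upwards [hA'] with t ht
  have hlim : Tendsto (fun s : T => t⁻¹ • s • j x) G (𝓝 (t⁻¹ • z)) := hGz.const_smul _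
  refine hUc.mem_of_tendsto hlim ?_
  filter_upwards [hA'] with s hs
  rw [← hjT, ← hjT]
  apply hεU
  rw [Metric.mem_ball, ← mul_smul, dist_inv_smul_smul]
  exact hAε _ hs _ ht

end AlmostAutomorphic

/-! ### The two topologies of a Veech system -/

theorem IsVeechMetric.secondCountableTopology {T : Type v} {X : Type u} [Group T]
    [TopologicalSpace X] [MulAction T X] {d : MetricSpace X} (hd : IsVeechMetric T X d) :
    @SecondCountableTopology X d.toUniformSpace.toTopologicalSpace :=
  @UniformSpace.secondCountable_of_separable X d.toUniformSpace
    (@EMetric.instIsCountablyGeneratedUniformity X _) hd.separable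

theorem IsVeechMetric.borelSpace {T : Type v} {X : Type u} [Group T] [τ : TopologicalSpace X]
    [m : MeasurableSpace X] [b : BorelSpace X] [MulAction T X] {d : MetricSpace X}
    (hd : IsVeechMetric T X d) : @BorelSpace X d.toUniformSpace.toTopologicalSpace m := by
  refine @BorelSpace.mk X d.toUniformSpace.toTopologicalSpace m (le_antisymm ?_ ?_)
  · rw [b.measurable_eq]
    exact borel_anti hd.finer
  · rw [b.measurable_eq]
    exact MeasurableSpace.generateFrom_le hd.measurable_of_isOpen

theorem IsVeechMetric.isIsometricSMul {T : Type v} {X : Type u} [Group T]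
    [TopologicalSpace X] [MulAction T X] {d : MetricSpace X} (hd : IsVeechMetric T X d) :
    @IsIsometricSMul T X d.toPseudoMetricSpace.toPseudoEMetricSpace _ :=
  @IsIsometricSMul.mk T X _ _ fun t =>
    @Isometry.of_dist_eq X X _ _ _ fun x y => hd.dist_smul t x y

/-- A Veech metric turned into a second metric space `E`, with an equivariant bijection onto `X`
that is continuous and an isomorphism of Borel spaces. Separating `E` from `X` keeps the two
topologies apart. -/
theorem IsVeechSystem.exists_metric_model {T : Type v} {X : Type u} [Group T]
    [τ : TopologicalSpace X] [m : MeasurableSpace X] [BorelSpace X] [a : MulAction T X]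
    (hX : IsVeechSystem T X) :
    ∃ (E : Type u) (_ : MetricSpace E) (_ : SecondCountableTopology E) (_ : MeasurableSpace E)
      (_ : BorelSpace E) (_ : MulAction T E) (_ : IsIsometricSMul T E) (j : E ≃ᵐ X),
      Continuous j ∧ ∀ (t : T) (e : E), j (t • e) = t • j e := by
  obtain ⟨d, hd⟩ := hX
  exact ⟨X, d, hd.secondCountableTopology, m, hd.borelSpace, a, hd.isIsometricSMul,
    MeasurableEquiv.refl X, @Continuous.mk X X d.toUniformSpace.toTopologicalSpace τ _ hd.finer,
    fun _ _ => rfl⟩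

/-- A compact topology has no strictly coarser Hausdorff topology. -/
theorem eq_of_le_of_compactSpace_of_t2Space {X : Type*} {τ τ' : TopologicalSpace X} (hle : τ ≤ τ')
    (hc : @CompactSpace X τ) (ht2 : @T2Space X τ') : τ = τ' := by
  refine le_antisymm hle fun s hs => ?_
  have hcl : @IsClosed X τ sᶜ := @IsOpen.isClosed_compl X τ s hs
  have hcl' : @IsClosed X τ' (id '' sᶜ) :=
    @Continuous.isClosedMap X X τ τ' hc ht2 id (@Continuous.mk X X τ τ' _ hle) _ hcl
  rw [Set.image_id] at hcl'
  exact (@isClosed_compl_iff X τ' s).1 hcl'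

/-- A compact Hausdorff space with a finer second countable topology is second countable: the
images of basic open sets form a countable network, which yields a coarser second countable
Hausdorff topology, and a compact topology has no strictly coarser Hausdorff one. -/
theorem secondCountableTopology_of_continuous_surjective {E X : Type*} [TopologicalSpace E]
    [SecondCountableTopology E] [τ : TopologicalSpace X] [CompactSpace X] [T2Space X] {j : E → X}
    (hj : Continuous j) (hjs : Function.Surjective j) : SecondCountableTopology X := by
  set B := TopologicalSpace.countableBasis E with hB
  have hBc : B.Countable := TopologicalSpace.countable_countableBasis E
  have hBb := TopologicalSpace.isBasis_countableBasis E
  have hex : ∀ p : Set E × Set E, ∃ U V : Set X, IsOpen U ∧ IsOpen V ∧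
      (SeparatedNhds (j '' p.1) (j '' p.2) → j '' p.1 ⊆ U ∧ j '' p.2 ⊆ V ∧ Disjoint U V) := by
    intro p
    by_cases h : SeparatedNhds (j '' p.1) (j '' p.2)
    · obtain ⟨U, V, hU, hV, h1, h2, h3⟩ := h
      exact ⟨U, V, hU, hV, fun _ => ⟨h1, h2, h3⟩⟩
    · exact ⟨∅, ∅, isOpen_empty, isOpen_empty, fun h' => (h h').elim⟩
  choose U V hU hV hUV using hex
  set 𝒮 : Set (Set X) := U '' (B ×ˢ B) ∪ V '' (B ×ˢ B) with h𝒮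
  have hc : 𝒮.Countable := ((hBc.prod hBc).image _).union ((hBc.prod hBc).image _)
  have hle : τ ≤ TopologicalSpace.generateFrom 𝒮 := by
    refine le_generateFrom ?_
    rintro _ (⟨p, _, rfl⟩ | ⟨p, _, rfl⟩)
    exacts [hU p, hV p]
  have ht2 : @T2Space X (TopologicalSpace.generateFrom 𝒮) := by
    refine @T2Space.mk X (TopologicalSpace.generateFrom 𝒮) ?_
    intro x y hxy
    obtain ⟨a, rfl⟩ := hjs x
    obtain ⟨b, rfl⟩ := hjs y
    obtain ⟨P, Q, hP, hQ, haP, hbQ, hPQ⟩ := t2_separation hxy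
    obtain ⟨P', hP'B, haP', hP'⟩ := hBb.exists_subset_of_mem_open
      (show a ∈ j ⁻¹' P from haP) (hP.preimage hj)
    obtain ⟨Q', hQ'B, hbQ', hQ'⟩ := hBb.exists_subset_of_mem_open
      (show b ∈ j ⁻¹' Q from hbQ) (hQ.preimage hj)
    obtain ⟨h1, h2, h3⟩ := hUV (P', Q')
      ⟨P, Q, hP, hQ, Set.image_subset_iff.2 hP', Set.image_subset_iff.2 hQ', hPQ⟩
    refine ⟨U (P', Q'), V (P', Q'), ?_, ?_, h1 ⟨a, haP', rfl⟩, h2 ⟨b, hbQ', rfl⟩, h3⟩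
    · exact TopologicalSpace.isOpen_generateFrom_of_mem (Or.inl ⟨_, ⟨hP'B, hQ'B⟩, rfl⟩)
    · exact TopologicalSpace.isOpen_generateFrom_of_mem (Or.inr ⟨_, ⟨hP'B, hQ'B⟩, rfl⟩)
  exact ⟨𝒮, hc, eq_of_le_of_compactSpace_of_t2Space hle inferInstance ht2⟩

theorem smul_symm_apply {T E X : Type*} [Group T] [MeasurableSpace E] [MulAction T E]
    [MeasurableSpace X] [MulAction T X] {j : E ≃ᵐ X}
    (hjT : ∀ (t : T) (e : E), j (t • e) = t • j e) (t : T) (x : X) :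
    j.symm (t • x) = t • j.symm x := by
  rw [MeasurableEquiv.symm_apply_eq, hjT, MeasurableEquiv.apply_symm_apply]

theorem preimage_symm_preimage_smul {T E X : Type*} [Group T] [MeasurableSpace E] [MulAction T E]
    [MeasurableSpace X] [MulAction T X] {j : E ≃ᵐ X}
    (hjT : ∀ (t : T) (e : E), j (t • e) = t • j e) (t : T) (s : Set E) :
    j.symm ⁻¹' ((t • ·) ⁻¹' s) = (t • ·) ⁻¹' (j.symm ⁻¹' s) := by
  ext x
  simp [smul_symm_apply hjT]

theorem smulInvariantMeasure_map_symm {T E X : Type*} [Group T] [MeasurableSpace E] [MulAction T E]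
    [MeasurableSpace X] [MulAction T X] [MeasurableConstSMul T X] {j : E ≃ᵐ X}
    (hjT : ∀ (t : T) (e : E), j (t • e) = t • j e)
    (μ : Measure X) [SMulInvariantMeasure T X μ] : SMulInvariantMeasure T E (μ.map j.symm) where
  measure_preimage_smul t s _ := by
    rw [MeasurableEquiv.map_apply, MeasurableEquiv.map_apply, preimage_symm_preimage_smul hjT,
      measure_preimage_smul]

theorem ergodicSMul_map_symm {T E X : Type*} [Group T] [MeasurableSpace E] [MulAction T E]
    [MeasurableSpace X] [MulAction T X] [MeasurableConstSMul T X] {j : E ≃ᵐ X}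
    (hjT : ∀ (t : T) (e : E), j (t • e) = t • j e)
    (μ : Measure X) [ErgodicSMul T X μ] : ErgodicSMul T E (μ.map j.symm) where
  toSMulInvariantMeasure := smulInvariantMeasure_map_symm hjT μ
  aeconst_of_forall_preimage_smul_ae_eq {s} hs h := by
    have hmp : Measure.QuasiMeasurePreserving j.symm μ (μ.map j.symm) :=
      ⟨j.symm.measurable, Measure.AbsolutelyContinuous.rfl⟩
    have hmp' : Measure.QuasiMeasurePreserving j (μ.map j.symm) μ :=
      ⟨j.measurable, by
        rw [Measure.map_map j.measurable j.symm.measurable, j.self_comp_symm, Measure.map_id]⟩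
    have h1 : EventuallyConst (j.symm ⁻¹' s) (ae μ) := by
      refine aeconst_of_forall_preimage_smul_ae_eq T (j.symm.measurable hs).nullMeasurableSet ?_
      intro g
      rw [← preimage_symm_preimage_smul hjT]
      exact hmp.preimage_ae_eq (h g)
    have h2 := h1.comp_tendsto hmp'.tendsto_ae
    have h3 : (j.symm ⁻¹' s : Set X) ∘ j = s := by
      ext e
      show j.symm (j e) ∈ s ↔ e ∈ s
      simp
    rwa [h3] at h2

section Model

variable {T : Type*} [Group T] {E X : Type*} [MetricSpace E] [SecondCountableTopology E]
  [MeasurableSpace E] [BorelSpace E] [MulAction T E] [IsIsometricSMul T E] [TopologicalSpace X]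
  [MeasurableSpace X] [BorelSpace X] [MulAction T X] [ContinuousConstSMul T X]
  [CompactSpace X] [T2Space X] {j : E ≃ᵐ X}

/-- The support of an ergodic measure is minimal: it is the closure of the image of the support
taken in the metric topology, whose points have almost automorphic image. -/
theorem isMinimalSet_support (hj : Continuous j) (hjT : ∀ (t : T) (e : E), j (t • e) = t • j e)
    (μ : Measure X) [IsProbabilityMeasure μ] [ErgodicSMul T X μ] : IsMinimalSet T μ.support := by
  have hm := ergodicSMul_map_symm hjT μ
  have hpm : IsProbabilityMeasure (μ.map j.symm) :=
    Measure.isProbabilityMeasure_map j.symm.measurable.aemeasurable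
  set m := μ.map j.symm with hmdef
  have hsub : ∀ e ∈ m.support, j e ∈ μ.support := by
    intro e he
    rw [Measure.mem_support_iff_forall] at he ⊢
    intro U hU
    have := he _ (hj.continuousAt.preimage_mem_nhds hU)
    rwa [hmdef, MeasurableEquiv.map_apply, ← Set.preimage_comp, j.self_comp_symm,
      Set.preimage_id] at this
  obtain ⟨e₀, he₀⟩ : m.support.Nonempty := Measure.nonempty_support (IsProbabilityMeasure.ne_zero m)
  have hsupp : μ.support ⊆ closure (MulAction.orbit T (j e₀)) := by
    refine Measure.support_subset_of_isClosed isClosed_closure ?_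
    have h1 : m.support ∈ ae m := Measure.support_mem_ae
    have h2 : ∀ᵐ x ∂μ, j.symm x ∈ m.support :=
      ae_of_ae_map j.symm.measurable.aemeasurable h1
    filter_upwards [h2] with x hx
    rw [← closure_orbit_eq_support (T := T) he₀] at hx
    have := image_closure_subset_closure_image hj (Set.mem_image_of_mem j hx)
    rw [j.apply_symm_apply] at this
    refine closure_mono ?_ this
    rintro _ ⟨_, ⟨t, rfl⟩, rfl⟩
    exact ⟨t, (hjT t e₀).symm⟩
  refine ⟨⟨_, hsub _ he₀⟩, Measure.isClosed_support, fun t x hx => smul_mem_support t hx, ?_⟩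
  intro z hz
  -- `z` is a limit of points `t • j e₀`, and then `t⁻¹ • z` tends to `j e₀`.
  have hclos : j e₀ ∈ closure (MulAction.orbit T z) := by
    obtain ⟨F, hF, hFz⟩ := mem_closure_iff_ultrafilter.1 (hsupp hz)
    have hne : (comap (fun t : T => t • j e₀) (F : Filter X)).NeBot :=
      F.neBot.comap_of_range_mem hF
    have := isAlmostAutomorphicPoint_of_totallyBounded hj hjT
      (totallyBounded_orbit_of_mem_support (T := T) he₀) _ z
      ((tendsto_comap (f := fun t : T => t • j e₀) (x := (F : Filter X))).mono_right hFz)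
    exact mem_closure_of_tendsto this (Eventually.of_forall fun t => ⟨t⁻¹, rfl⟩)
  refine hsupp.trans (closure_minimal ?_ isClosed_closure)
  rintro _ ⟨t, rfl⟩
  exact smul_closure_orbit_subset t z (Set.smul_mem_smul_set hclos)

end Model

/-! ### Invariant measures of actions of amenable groups -/

section Amenable

variable {T : Type*} [Group T] {X : Type*} [TopologicalSpace X] [MulAction T X]
  [ContinuousConstSMul T X]

/-- The function `x ↦ f (t • x)`. -/
def translate (t : T) (f : C(X, ℝ)) : C(X, ℝ) :=
  f.comp ⟨fun x => t • x, continuous_const_smul t⟩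

@[simp]
theorem translate_apply (t : T) (f : C(X, ℝ)) (x : X) : translate t f x = f (t • x) := rfl

variable (T X) in
/-- Normalized positive linear functionals on `C(X, ℝ)` that are invariant under `T`, as a subset
of the space of all functions `C(X, ℝ) → ℝ` with the topology of pointwise convergence. -/
def invariantStates : Set (C(X, ℝ) → ℝ) :=
  {Λ | (∀ f g, Λ (f + g) = Λ f + Λ g) ∧ (∀ (c : ℝ) f, Λ (c • f) = c * Λ f) ∧
    (∀ f, 0 ≤ f → 0 ≤ Λ f) ∧ Λ 1 = 1 ∧ ∀ (t : T) f, Λ (translate t f) = Λ f}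

theorem isClosed_invariantStates : IsClosed (invariantStates T X) := by
  have hc : ∀ f : C(X, ℝ), Continuous fun Λ : C(X, ℝ) → ℝ => Λ f := continuous_apply
  simp only [invariantStates, Set.ofPred_and, Set.ofPred_forall]
  refine IsClosed.inter ?_ (IsClosed.inter ?_ (IsClosed.inter ?_ (IsClosed.inter ?_ ?_)))
  · exact isClosed_iInter fun f => isClosed_iInter fun g => isClosed_eq (hc _) ((hc _).add (hc _))
  · exact isClosed_iInter fun c => isClosed_iInter fun f =>
      isClosed_eq (hc _) (continuous_const.mul (hc _))
  · exact isClosed_iInter fun f => isClosed_iInter fun _ => isClosed_le continuous_const (hc _)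
  · exact isClosed_eq (hc _) continuous_const
  · exact isClosed_iInter fun t => isClosed_iInter fun f => isClosed_eq (hc _) (hc _)

variable [CompactSpace X]

theorem isCompact_invariantStates : IsCompact (invariantStates T X) := by
  refine (isCompact_univ_pi fun f : C(X, ℝ) =>
    isCompact_Icc (a := -‖f‖) (b := ‖f‖)).of_isClosed_subset isClosed_invariantStates ?_
  rintro Λ ⟨hadd, hsmul, hpos, hone, -⟩ f -
  have h1 : 0 ≤ Λ (‖f‖ • 1 + f) := hpos _ fun x => by
    have := neg_abs_le (f x)
    have h2 := f.norm_coe_le_norm x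
    rw [Real.norm_eq_abs] at h2
    simp
    linarith
  have h2 : 0 ≤ Λ (‖f‖ • 1 + (-1 : ℝ) • f) := hpos _ fun x => by
    have := le_abs_self (f x)
    have h2 := f.norm_coe_le_norm x
    rw [Real.norm_eq_abs] at h2
    simp
    linarith
  rw [hadd, hsmul, hone] at h1
  rw [hadd, hsmul, hsmul, hone] at h2
  constructor <;> linarith

/-- The average of `f` over `F • x`. -/
def orbitAverage (F : Finset T) (x : X) (f : C(X, ℝ)) : ℝ :=
  (∑ s ∈ F, f (s • x)) / (F.card : ℝ)

omit [ContinuousConstSMul T X] in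
theorem abs_orbitAverage_le (F : Finset T) (hF : F.Nonempty) (x : X) (f : C(X, ℝ)) :
    |orbitAverage F x f| ≤ ‖f‖ := by
  have hc : (0 : ℝ) < F.card := by exact_mod_cast hF.card_pos
  rw [orbitAverage, abs_div, abs_of_pos hc, div_le_iff₀ hc]
  calc |∑ s ∈ F, f (s • x)| ≤ ∑ s ∈ F, |f (s • x)| := Finset.abs_sum_le_sum_abs _ _
    _ ≤ ∑ s ∈ F, ‖f‖ := Finset.sum_le_sum fun s _ => f.norm_coe_le_norm _
    _ = ‖f‖ * F.card := by rw [Finset.sum_const, nsmul_eq_mul, mul_comm]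

open scoped Classical in
theorem abs_orbitAverage_translate_sub_le (F : Finset T) (x : X) (f : C(X, ℝ)) (t : T) :
    |orbitAverage F x (translate t f) - orbitAverage F x f| ≤
      ‖f‖ * (((symmDiff (F.image (fun s => t * s)) F).card : ℝ) / (F.card : ℝ)) := by
  set g : T → ℝ := fun s => f (s • x) with hg
  set A := F.image (fun s => t * s) with hA
  have h1 : ∑ s ∈ F, translate t f (s • x) = ∑ s ∈ A, g s := by
    rw [hA, Finset.sum_image fun a _ b _ h => mul_left_cancel h]
    simp [hg, mul_smul]
  -- The sums over `A` and `F` differ only on the symmetric difference.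
  have h2 : ∑ s ∈ A, g s - ∑ s ∈ F, g s = ∑ s ∈ A \ F, g s - ∑ s ∈ F \ A, g s := by
    rw [← Finset.sum_inter_add_sum_sdiff A F, ← Finset.sum_inter_add_sum_sdiff F A,
      Finset.inter_comm F A]
    ring
  have h3 : (symmDiff A F).card = (A \ F).card + (F \ A).card := by
    rw [symmDiff_def, Finset.sup_eq_union, Finset.card_union_of_disjoint disjoint_sdiff_sdiff]
  have hb : ∀ B : Finset T, |∑ s ∈ B, g s| ≤ ‖f‖ * B.card := fun B =>
    calc |∑ s ∈ B, g s| ≤ ∑ s ∈ B, |g s| := Finset.abs_sum_le_sum_abs _ _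
      _ ≤ ∑ s ∈ B, ‖f‖ := Finset.sum_le_sum fun s _ => f.norm_coe_le_norm _
      _ = ‖f‖ * B.card := by rw [Finset.sum_const, nsmul_eq_mul, mul_comm]
  rw [orbitAverage, orbitAverage, ← sub_div, h1, h2, abs_div, Nat.abs_cast, ← mul_div_assoc]
  gcongr
  calc |∑ s ∈ A \ F, g s - ∑ s ∈ F \ A, g s|
      ≤ |∑ s ∈ A \ F, g s| + |∑ s ∈ F \ A, g s| := abs_sub _ _
    _ ≤ ‖f‖ * (A \ F).card + ‖f‖ * (F \ A).card := add_le_add (hb _) (hb _)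
    _ = ‖f‖ * ((symmDiff A F).card : ℝ) := by rw [h3]; push_cast; ring

/-- Limits of averages over a Følner sequence are invariant states. -/
theorem IsAmenable.invariantStates_nonempty [Nonempty X] (hT : IsAmenable T) :
    (invariantStates T X).Nonempty := by
  obtain ⟨F, hFne, hF⟩ := hT
  obtain ⟨x⟩ := ‹Nonempty X›
  have hcpt := isCompact_univ_pi fun f : C(X, ℝ) => isCompact_Icc (a := -‖f‖) (b := ‖f‖)
  obtain ⟨Λ, -, hΛ⟩ := hcpt.ultrafilter_le_nhds
    ((hyperfilter ℕ).map fun n => orbitAverage (F n) x) (by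
      rw [Ultrafilter.coe_map, le_principal_iff]
      refine Filter.mem_map.2 (univ_mem' fun n f _ => ?_)
      exact abs_le.1 (abs_orbitAverage_le (F n) (hFne n) x f))
  have hlim : ∀ f, Tendsto (fun n => orbitAverage (F n) x f) (hyperfilter ℕ) (𝓝 (Λ f)) :=
    tendsto_pi_nhds.1 hΛ
  refine ⟨Λ, fun f g => ?_, fun c f => ?_, fun f hf => ?_, ?_, fun t f => ?_⟩
  · refine tendsto_nhds_unique (hlim _) (((hlim f).add (hlim g)).congr fun n => ?_)
    simp [orbitAverage, Finset.sum_add_distrib, add_div]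
  · refine tendsto_nhds_unique (hlim _) (((hlim f).const_mul c).congr fun n => ?_)
    simp [orbitAverage, ← Finset.mul_sum, mul_div_assoc]
  · refine ge_of_tendsto' (hlim f) fun n => ?_
    exact div_nonneg (Finset.sum_nonneg fun s _ => hf _) (Nat.cast_nonneg _)
  · refine tendsto_nhds_unique (hlim _) (tendsto_const_nhds.congr fun n => ?_)
    have : ((F n).card : ℝ) ≠ 0 := by exact_mod_cast (hFne n).card_pos.ne'
    simp [orbitAverage, this]
  · have h0 : Tendsto (fun n => orbitAverage (F n) x (translate t f) - orbitAverage (F n) x f)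
        (hyperfilter ℕ) (𝓝 0) := by
      refine squeeze_zero_norm (fun n => abs_orbitAverage_translate_sub_le (F n) x f t) ?_
      have := ((hF t).const_mul ‖f‖).mono_left (Nat.hyperfilter_le_atTop)
      simpa using this
    have h1 := (hlim (translate t f)).sub (hlim f)
    linarith [tendsto_nhds_unique h1 h0]

variable [T2Space X] [SecondCountableTopology X] [MeasurableSpace X] [BorelSpace X]

omit [MulAction T X] [ContinuousConstSMul T X] in
theorem measure_ext_of_forall_integral_eq {μ ν : Measure X} [IsFiniteMeasure μ]
    [IsFiniteMeasure ν] (h : ∀ f : C(X, ℝ), ∫ x, f x ∂μ = ∫ x, f x ∂ν) : μ = ν := by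
  let := TopologicalSpace.metrizableSpaceMetric X
  exact ext_of_forall_integral_eq_of_IsFiniteMeasure fun f => h f.toContinuousMap

theorem exists_measure_of_mem_invariantStates {Λ : C(X, ℝ) → ℝ} (hΛ : Λ ∈ invariantStates T X) :
    ∃ μ : Measure X, IsProbabilityMeasure μ ∧ SMulInvariantMeasure T X μ ∧
      ∀ f : C(X, ℝ), ∫ x, f x ∂μ = Λ f := by
  obtain ⟨hadd, hsmul, hpos, hone, hinv⟩ := hΛ
  let L : CompactlySupportedContinuousMap X ℝ →ₚ[ℝ] ℝ := PositiveLinearMap.mk₀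
    { toFun := fun f => Λ f.toContinuousMap
      map_add' := fun f g => hadd _ _
      map_smul' := fun c f => hsmul _ _ } (fun f hf => hpos _ hf)
  have hint : ∀ f : C(X, ℝ), ∫ x, f x ∂(RealRMK.rieszMeasure L) = Λ f := fun f =>
    RealRMK.integral_rieszMeasure L ⟨f, HasCompactSupport.of_compactSpace _⟩
  have hprob : IsProbabilityMeasure (RealRMK.rieszMeasure L) := by
    have h1 := hint 1
    rw [hone] at h1
    simp only [ContinuousMap.one_apply, integral_const, smul_eq_mul, mul_one] at h1
    refine ⟨?_⟩
    rwa [measureReal_def, ENNReal.toReal_eq_one_iff] at h1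
  refine ⟨RealRMK.rieszMeasure L, hprob, ?_, hint⟩
  have hmap : ∀ t : T, (RealRMK.rieszMeasure L).map (t • ·) = RealRMK.rieszMeasure L := by
    intro t
    have := Measure.isProbabilityMeasure_map (μ := RealRMK.rieszMeasure L)
      (measurable_const_smul t : Measurable fun x : X => t • x).aemeasurable
    refine measure_ext_of_forall_integral_eq fun f => ?_
    rw [integral_map (measurable_const_smul t).aemeasurable f.continuous.aestronglyMeasurable]
    exact (hint (translate t f)).trans ((hinv t f).trans (hint f).symm)
  refine ⟨fun t s hs => ?_⟩
  rw [← Measure.map_apply (measurable_const_smul t) hs, hmap t]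

theorem IsAmenable.exists_invariant_measure [Nonempty X] (hT : IsAmenable T) :
    ∃ μ : Measure X, IsProbabilityMeasure μ ∧ SMulInvariantMeasure T X μ := by
  obtain ⟨Λ, hΛ⟩ := hT.invariantStates_nonempty (X := X)
  obtain ⟨μ, h1, h2, -⟩ := exists_measure_of_mem_invariantStates hΛ
  exact ⟨μ, h1, h2⟩

omit [T2Space X] [SecondCountableTopology X] in
/-- The normalized restriction of an invariant measure to an almost invariant set of positive
measure yields an invariant state. -/
theorem integral_restrict_mem_invariantStates (μ : Measure X) [IsProbabilityMeasure μ]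
    [SMulInvariantMeasure T X μ] {s : Set X} (hs : μ s ≠ 0)
    (hinv : ∀ t : T, (t • ·) ⁻¹' s =ᵐ[μ] s) :
    (fun f : C(X, ℝ) => (μ.real s)⁻¹ * ∫ x in s, f x ∂μ) ∈ invariantStates T X := by
  have hs' : μ.real s ≠ 0 := by
    rw [measureReal_def]; exact ENNReal.toReal_ne_zero.2 ⟨hs, measure_ne_top _ _⟩
  have hint : ∀ f : C(X, ℝ), Integrable f (μ.restrict s) := fun f =>
    (BoundedContinuousFunction.mkOfCompact f).integrable _
  refine ⟨fun f g => ?_, fun c f => ?_, fun f hf => ?_, ?_, fun t f => ?_⟩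
  · simp only [ContinuousMap.add_apply]
    rw [integral_add (hint f) (hint g), mul_add]
  · simp only [ContinuousMap.smul_apply, smul_eq_mul]
    rw [integral_const_mul]
    ring
  · exact mul_nonneg (inv_nonneg.2 measureReal_nonneg) (integral_nonneg fun x => hf x)
  · simp [hs']
  · have hmp := measurePreserving_smul t μ
    have he : MeasurableEmbedding fun x : X => t • x := measurableEmbedding_const_smul t
    have h1 := hmp.setIntegral_preimage_emb he (fun x => f x) s
    rw [setIntegral_congr_set (hinv t)] at h1
    simp only [translate_apply]
    rw [h1]

/-- Extreme points of the set of invariant states, which exist by the Krein–Milman theorem, are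
given by ergodic measures. -/
theorem IsAmenable.exists_ergodic_measure [Nonempty X] (hT : IsAmenable T) :
    ∃ μ : Measure X, IsProbabilityMeasure μ ∧ ErgodicSMul T X μ := by
  obtain ⟨Λ, hΛ⟩ := (isCompact_invariantStates (T := T) (X := X)).extremePoints_nonempty
    hT.invariantStates_nonempty
  obtain ⟨μ, hμ, hμT, hμΛ⟩ := exists_measure_of_mem_invariantStates hΛ.1
  refine ⟨μ, hμ, ⟨fun {s} hs hinv => ?_⟩⟩
  by_contra hcon
  rw [eventuallyConst_set'] at hcon
  push Not at hcon
  have h0 : μ s ≠ 0 := fun h => hcon.1 (ae_eq_empty.2 h)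
  have h1 : μ sᶜ ≠ 0 := fun h => hcon.2 (ae_eq_univ.2 h)
  have hinv' : ∀ t : T, (t • ·) ⁻¹' sᶜ =ᵐ[μ] (sᶜ : Set X) := fun t => (hinv t).compl
  have hΛ1 := integral_restrict_mem_invariantStates μ h0 hinv
  have hΛ2 := integral_restrict_mem_invariantStates μ h1 hinv'
  have hp0 : 0 < μ.real s := ENNReal.toReal_pos h0 (measure_ne_top _ _)
  have hp1 : 0 < μ.real sᶜ := ENNReal.toReal_pos h1 (measure_ne_top _ _)
  -- `Λ` is a proper convex combination of its normalized restrictions to `s` and `sᶜ`; being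
  -- extreme it equals the first, whose measure gives no mass to `sᶜ`.
  have heq := hΛ.2 hΛ1 hΛ2 ⟨μ.real s, μ.real sᶜ, hp0, hp1, by
    rw [measureReal_compl hs]; simp, by
    ext f
    simp only [Pi.add_apply, Pi.smul_apply, smul_eq_mul]
    rw [mul_inv_cancel_left₀ hp0.ne', mul_inv_cancel_left₀ hp1.ne', ← hμΛ f]
    exact integral_add_compl hs ((BoundedContinuousFunction.mkOfCompact f).integrable _)⟩
  have hmeas : (μ s)⁻¹ • μ.restrict s = μ := by
    have : IsFiniteMeasure ((μ s)⁻¹ • μ.restrict s) :=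
      Measure.smul_finite _ (ENNReal.inv_ne_top.2 h0)
    refine measure_ext_of_forall_integral_eq fun f => ?_
    rw [integral_smul_measure, hμΛ f, ENNReal.toReal_inv, smul_eq_mul]
    exact congrFun heq f
  have := congrArg (fun ν : Measure X => ν sᶜ) hmeas
  simp [Measure.restrict_apply hs.compl] at this
  exact h1 this.symm

end Amenable

/-! ### An invariant kernel -/

section Bump

variable {E : Type*} [MetricSpace E]

/-- The tent function of radius `ε` around `x`. -/
def bump (ε : ℝ) (x y : E) : ℝ := max 0 (1 - dist x y / ε)

theorem bump_nonneg (ε : ℝ) (x y : E) : 0 ≤ bump ε x y := le_max_left _ _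

theorem bump_le_one {ε : ℝ} (hε : 0 < ε) (x y : E) : bump ε x y ≤ 1 :=
  max_le zero_le_one (by linarith [div_nonneg (dist_nonneg (x := x) (y := y)) hε.le])

theorem norm_bump_le_one {ε : ℝ} (hε : 0 < ε) (x y : E) : ‖bump ε x y‖ ≤ 1 := by
  rw [Real.norm_of_nonneg (bump_nonneg ε x y)]
  exact bump_le_one hε x y

theorem bump_comm (ε : ℝ) (x y : E) : bump ε x y = bump ε y x := by
  rw [bump, bump, dist_comm]

theorem dist_lt_of_bump_ne_zero {ε : ℝ} (hε : 0 < ε) {x y : E} (h : bump ε x y ≠ 0) :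
    dist x y < ε := by
  by_contra hlt
  apply h
  rw [bump, max_eq_left]
  have := (one_le_div hε).2 (not_lt.1 hlt)
  linarith

theorem abs_bump_sub_bump_le {ε : ℝ} (hε : 0 < ε) (x x' y : E) :
    |bump ε x y - bump ε x' y| ≤ dist x x' / ε := by
  rw [bump, bump]
  refine (abs_max_sub_max_le_max _ _ _ _).trans ?_
  rw [sub_self, abs_zero, max_eq_right (abs_nonneg _), sub_sub_sub_cancel_left, ← sub_div, abs_div,
    abs_of_pos hε]
  gcongr
  rw [dist_comm x x']
  simpa [dist_comm] using abs_dist_sub_le x' x y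

theorem continuous_bump (ε : ℝ) : Continuous fun p : E × E => bump ε p.1 p.2 := by
  unfold bump
  fun_prop

theorem continuous_bump_right (ε : ℝ) (x : E) : Continuous (bump ε x) :=
  (continuous_bump ε).comp (Continuous.prodMk_right x)

theorem bump_smul_smul {T : Type*} [Group T] [MulAction T E] [IsIsometricSMul T E] (ε : ℝ) (t : T)
    (x y : E) : bump ε (t • x) (t • y) = bump ε x y := by
  rw [bump, bump, dist_smul]

variable [MeasurableSpace E] [BorelSpace E]

theorem integrable_bump {ε : ℝ} (hε : 0 < ε) (ν : Measure E) [IsFiniteMeasure ν] (x : E) :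
    Integrable (bump ε x) ν :=
  Integrable.of_bound (continuous_bump_right ε x).measurable.aestronglyMeasurable 1
    (ae_of_all _ fun y => norm_bump_le_one hε x y)

/-- The `ν`-mass of the tent function of radius `ε` around `x`. -/
def bumpMass (ν : Measure E) (ε : ℝ) (x : E) : ℝ := ∫ y, bump ε x y ∂ν

theorem continuous_bumpMass {ε : ℝ} (hε : 0 < ε) (ν : Measure E) [IsProbabilityMeasure ν] :
    Continuous (bumpMass ν ε) := by
  refine continuous_iff_continuousAt.2 fun x => ?_
  refine continuousAt_of_dominated (bound := fun _ => 1) ?_ ?_ (integrable_const _) ?_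
  · exact Eventually.of_forall fun x' =>
      (continuous_bump_right ε x').measurable.aestronglyMeasurable
  · exact Eventually.of_forall fun x' => ae_of_all _ fun y => norm_bump_le_one hε x' y
  · exact ae_of_all _ fun y =>
      ((continuous_bump ε).comp (Continuous.prodMk_left y)).continuousAt

theorem bumpMass_pos {ε : ℝ} (hε : 0 < ε) {ν : Measure E} [IsFiniteMeasure ν] {x : E}
    (hx : x ∈ ν.support) : 0 < bumpMass ν ε x := by
  rw [bumpMass, integral_pos_iff_support_of_nonneg (fun y => bump_nonneg ε x y)
    (integrable_bump hε ν x)]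
  refine ((Measure.mem_support_iff_forall x).1 hx _ (Metric.ball_mem_nhds x hε)).trans_le
    (measure_mono fun y hy => ?_)
  rw [Metric.mem_ball, dist_comm] at hy
  have : 0 < 1 - dist x y / ε := by
    have := (div_lt_one hε).2 hy
    linarith
  exact (this.trans_le (le_max_right _ _)).ne'

variable {T : Type*} [Group T] [MulAction T E] [IsIsometricSMul T E]

theorem bumpMass_smul (ν : Measure E) [SMulInvariantMeasure T E ν] (ε : ℝ) (t : T) (x : E) :
    bumpMass ν ε (t • x) = bumpMass ν ε x := by
  have := (measurePreserving_smul t ν).integral_comp (measurableEmbedding_const_smul t)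
    (bump ε (t • x))
  simp only [bump_smul_smul] at this
  exact this.symm

theorem bumpMass_eq_of_mem_closure_orbit {ε : ℝ} (hε : 0 < ε) (ν : Measure E)
    [IsProbabilityMeasure ν] [SMulInvariantMeasure T E ν] {x y : E}
    (hy : y ∈ closure (MulAction.orbit T x)) : bumpMass ν ε y = bumpMass ν ε x := by
  have hcl : IsClosed {z | bumpMass ν ε z = bumpMass ν ε x} :=
    isClosed_eq (continuous_bumpMass hε ν) continuous_const
  refine closure_minimal ?_ hcl hy
  rintro _ ⟨t, rfl⟩
  exact bumpMass_smul ν ε t x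

/-- A minimal isometric action on a compact metric space has at most one invariant probability
measure. The mass of a small tent is the same constant for both measures, by Fubini's theorem, and
dividing by it, a smoothed integral of `f` can be computed with either measure. -/
theorem invariant_measure_unique_of_isMinimal [CompactSpace E] [MulAction.IsMinimal T E]
    (μ ν : Measure E) [IsProbabilityMeasure μ] [IsProbabilityMeasure ν]
    [SMulInvariantMeasure T E μ] [SMulInvariantMeasure T E ν] : μ = ν := by
  refine measure_ext_of_forall_integral_eq fun f => ?_
  obtain ⟨x₀, hx₀⟩ : ν.support.Nonempty :=
    Measure.nonempty_support (IsProbabilityMeasure.ne_zero ν)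
  refine eq_of_forall_dist_le fun δ hδ => ?_
  obtain ⟨ε, hε, hfε⟩ := Metric.uniformContinuous_iff.1
    (CompactSpace.uniformContinuous_of_continuous f.continuous) δ hδ
  have hμc : ∀ y, bumpMass μ ε y = bumpMass μ ε x₀ := fun y =>
    bumpMass_eq_of_mem_closure_orbit (T := T) hε μ (MulAction.dense_orbit T x₀ y)
  have hνc : ∀ y, bumpMass ν ε y = bumpMass ν ε x₀ := fun y =>
    bumpMass_eq_of_mem_closure_orbit (T := T) hε ν (MulAction.dense_orbit T x₀ y)
  have hint : ∀ g : E × E → ℝ, Continuous g → Integrable g (μ.prod ν) := fun g hg =>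
    (BoundedContinuousFunction.mkOfCompact ⟨g, hg⟩).integrable _
  have hb := continuous_bump (E := E) ε
  have hbf₁ : Continuous fun p : E × E => bump ε p.1 p.2 * f p.1 := by fun_prop
  have hbf₂ : Continuous fun p : E × E => bump ε p.1 p.2 * f p.2 := by fun_prop
  have hν : ∫ p : E × E, bump ε p.1 p.2 ∂(μ.prod ν) = bumpMass ν ε x₀ := by
    have h1 : ∫ p : E × E, bump ε p.1 p.2 ∂(μ.prod ν) = ∫ x, bumpMass ν ε x ∂μ :=
      integral_prod _ (hint _ hb)
    simpa [hνc] using h1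
  have hμ : ∫ p : E × E, bump ε p.1 p.2 ∂(μ.prod ν) = bumpMass μ ε x₀ := by
    have h1 : ∫ p : E × E, bump ε p.1 p.2 ∂(μ.prod ν) = ∫ y, ∫ x, bump ε x y ∂μ ∂ν :=
      integral_prod_symm _ (hint _ hb)
    have h2 : ∀ y, ∫ x, bump ε x y ∂μ = bumpMass μ ε x₀ := fun y => by
      simp only [bump_comm ε _ y]
      exact hμc y
    simpa [h2] using h1
  -- Both sides of `hI` and `hJ` smooth `f` with the tent kernel; the left sides differ by at most
  -- `δ` times the mass of the kernel, which is supported where `dist p.1 p.2 < ε`.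
  have hI : ∫ p : E × E, bump ε p.1 p.2 * f p.1 ∂(μ.prod ν)
      = bumpMass ν ε x₀ * ∫ x, f x ∂μ := by
    refine (integral_prod _ (hint _ hbf₁)).trans ?_
    rw [← integral_const_mul]
    refine integral_congr_ae (ae_of_all _ fun x => ?_)
    simp only
    rw [integral_mul_const, ← hνc x]
    rfl
  have hJ : ∫ p : E × E, bump ε p.1 p.2 * f p.2 ∂(μ.prod ν)
      = bumpMass ν ε x₀ * ∫ x, f x ∂ν := by
    refine (integral_prod_symm _ (hint _ hbf₂)).trans ?_
    rw [← integral_const_mul]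
    refine integral_congr_ae (ae_of_all _ fun x => ?_)
    simp only
    rw [integral_mul_const, ← hν, hμ, ← hμc x]
    simp only [bump_comm ε _ x]
    rfl
  have hB : ∫ p : E × E, bump ε p.1 p.2 * δ ∂(μ.prod ν) = bumpMass ν ε x₀ * δ := by
    rw [integral_mul_const, hν]
  have hpos := bumpMass_pos hε hx₀
  have hdiff : |bumpMass ν ε x₀ * ∫ x, f x ∂μ - bumpMass ν ε x₀ * ∫ x, f x ∂ν|
      ≤ bumpMass ν ε x₀ * δ := by
    rw [← hI, ← hJ, ← hB, ← integral_sub (hint _ hbf₁) (hint _ hbf₂)]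
    refine norm_integral_le_of_norm_le (f := fun p : E × E =>
      bump ε p.1 p.2 * f p.1 - bump ε p.1 p.2 * f p.2) (hint _ (hb.mul continuous_const))
      (ae_of_all _ fun p => ?_)
    rw [← mul_sub, norm_mul, Real.norm_of_nonneg (bump_nonneg _ _ _)]
    by_cases h : bump ε p.1 p.2 = 0
    · simp [h]
    · gcongr
      · exact bump_nonneg _ _ _
      · exact (hfε (dist_lt_of_bump_ne_zero hε h)).le
  rw [← mul_sub, abs_mul, abs_of_pos hpos] at hdiff
  exact le_of_mul_le_mul_left hdiff hpos

end Bump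

/-! ### Discrete spectrum -/

section Spectrum

open scoped InnerProductSpace

variable {E : Type*} [MetricSpace E]

/-- The tent function of radius `ε` around `x` as a bounded continuous complex function. -/
def bumpBCF (ε : ℝ) (hε : 0 < ε) (x : E) : BoundedContinuousFunction E ℂ :=
  BoundedContinuousFunction.ofNormedAddCommGroup (fun y => (bump ε x y : ℂ))
    (Complex.continuous_ofReal.comp (continuous_bump_right ε x)) 1
    (fun y => by rw [Complex.norm_real]; exact norm_bump_le_one hε x y)

variable [MeasurableSpace E] [BorelSpace E] (μ : Measure E) [IsProbabilityMeasure μ]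

theorem norm_toLp_le (f : BoundedContinuousFunction E ℂ) :
    ‖BoundedContinuousFunction.toLp 2 μ ℂ f‖ ≤ ‖f‖ := by
  refine (ContinuousLinearMap.le_opNorm _ _).trans ?_
  have h : ‖(BoundedContinuousFunction.toLp 2 μ ℂ : BoundedContinuousFunction E ℂ →L[ℂ] _)‖ ≤ 1 :=
    (BoundedContinuousFunction.toLp_norm_le μ).trans (by simp [measureUnivNNReal])
  exact mul_le_of_le_one_left (norm_nonneg _) h

/-- The tent function of radius `ε` around `x` as an element of `L²`. -/
def bumpLp (ε : ℝ) (hε : 0 < ε) (x : E) : Lp ℂ 2 μ :=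
  BoundedContinuousFunction.toLp 2 μ ℂ (bumpBCF ε hε x)

theorem norm_bumpLp_le {ε : ℝ} (hε : 0 < ε) (x : E) : ‖bumpLp μ ε hε x‖ ≤ 1 :=
  (norm_toLp_le μ _).trans
    (BoundedContinuousFunction.norm_ofNormedAddCommGroup_le _ zero_le_one _)

theorem norm_bumpLp_sub_le {ε : ℝ} (hε : 0 < ε) (x x' : E) :
    ‖bumpLp μ ε hε x - bumpLp μ ε hε x'‖ ≤ dist x x' / ε := by
  rw [bumpLp, bumpLp, ← map_sub]
  refine (norm_toLp_le μ _).trans ?_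
  refine (BoundedContinuousFunction.norm_le (by positivity)).2 fun y => ?_
  have : (bumpBCF ε hε x - bumpBCF ε hε x') y = ((bump ε x y - bump ε x' y : ℝ) : ℂ) := by
    push_cast; rfl
  rw [this, Complex.norm_real]
  exact abs_bump_sub_bump_le hε x x' y

theorem inner_bumpLp {ε : ℝ} (hε : 0 < ε) (x : E) (f : Lp ℂ 2 μ) :
    ⟪bumpLp μ ε hε x, f⟫_ℂ = ∫ y, (bump ε x y : ℂ) * f y ∂μ := by
  rw [L2.inner_def]
  refine integral_congr_ae ?_
  filter_upwards [BoundedContinuousFunction.coeFn_toLp 2 μ ℂ (bumpBCF ε hε x)] with y hy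
  rw [bumpLp, hy, RCLike.inner_apply]
  have : bumpBCF ε hε x y = (bump ε x y : ℂ) := rfl
  rw [this, Complex.conj_ofReal, mul_comm]

theorem continuous_bumpLp {ε : ℝ} (hε : 0 < ε) : Continuous (bumpLp μ ε hε) := by
  refine (LipschitzWith.of_dist_le' (K := ε⁻¹) fun x x' => ?_).continuous
  rw [dist_eq_norm]
  exact (norm_bumpLp_sub_le μ hε x x').trans_eq (div_eq_inv_mul _ _)

theorem norm_inner_bumpLp_le {ε : ℝ} (hε : 0 < ε) (x : E) (f : Lp ℂ 2 μ) :
    ‖⟪bumpLp μ ε hε x, f⟫_ℂ‖ ≤ ‖f‖ :=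
  (norm_inner_le_norm (𝕜 := ℂ) (bumpLp μ ε hε x) f).trans
    (mul_le_of_le_one_left (norm_nonneg _) (norm_bumpLp_le μ hε x))

/-- The function `x ↦ ∫ bump ε x y * f y ∂μ(y)`, as a bounded continuous function of `x`. -/
def smoothing (ε : ℝ) (hε : 0 < ε) : Lp ℂ 2 μ →L[ℂ] BoundedContinuousFunction E ℂ :=
  LinearMap.mkContinuous
    { toFun := fun f => BoundedContinuousFunction.ofNormedAddCommGroup
        (fun x => ⟪bumpLp μ ε hε x, f⟫_ℂ)
        ((continuous_bumpLp μ hε).inner continuous_const) ‖f‖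
        (fun x => norm_inner_bumpLp_le μ hε x f)
      map_add' := fun f g => by
        ext x
        exact inner_add_right (𝕜 := ℂ) (bumpLp μ ε hε x) f g
      map_smul' := fun c f => by
        ext x
        exact inner_smul_right (𝕜 := ℂ) (bumpLp μ ε hε x) f c }
    1 (fun f => by
      rw [one_mul]
      exact (BoundedContinuousFunction.norm_le (norm_nonneg _)).2 fun x =>
        norm_inner_bumpLp_le μ hε x f)

theorem smoothing_apply {ε : ℝ} (hε : 0 < ε) (f : Lp ℂ 2 μ) (x : E) :
    smoothing μ ε hε f x = ⟪bumpLp μ ε hε x, f⟫_ℂ := rfl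

/-- The integral operator on `L²` with kernel `bump ε`. -/
def kernelOp (ε : ℝ) (hε : 0 < ε) : Lp ℂ 2 μ →L[ℂ] Lp ℂ 2 μ :=
  (BoundedContinuousFunction.toLp 2 μ ℂ) ∘L (smoothing μ ε hε)

theorem kernelOp_ae_eq {ε : ℝ} (hε : 0 < ε) (f : Lp ℂ 2 μ) :
    kernelOp μ ε hε f =ᵐ[μ] smoothing μ ε hε f :=
  BoundedContinuousFunction.coeFn_toLp 2 μ ℂ _

theorem isSymmetric_kernelOp [SecondCountableTopology E] {ε : ℝ} (hε : 0 < ε) :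
    (kernelOp μ ε hε : Lp ℂ 2 μ →ₗ[ℂ] Lp ℂ 2 μ).IsSymmetric := by
  intro f g
  have hfi : Integrable f μ := (Lp.memLp f).integrable one_le_two
  have hgi : Integrable g μ := (Lp.memLp g).integrable one_le_two
  have hfc : Integrable (fun y => (starRingEnd ℂ) (f y)) μ :=
    hfi.norm.mono' (RCLike.continuous_conj.comp_aestronglyMeasurable hfi.aestronglyMeasurable)
      (ae_of_all _ fun y => by simp)
  have hprod : Integrable (fun p : E × E =>
      (bump ε p.1 p.2 : ℂ) * (g p.1 * (starRingEnd ℂ) (f p.2))) (μ.prod μ) := by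
    refine Integrable.bdd_mul (c := 1) (hgi.mul_prod hfc) ?_ ?_
    · exact (Complex.continuous_ofReal.comp (continuous_bump ε)).measurable.aestronglyMeasurable
    · exact ae_of_all _ fun p => by rw [Complex.norm_real]; exact norm_bump_le_one hε _ _
  have h1 : ⟪kernelOp μ ε hε f, g⟫_ℂ
      = ∫ x, ∫ y, (bump ε x y : ℂ) * (g x * (starRingEnd ℂ) (f y)) ∂μ ∂μ := by
    rw [L2.inner_def]
    refine integral_congr_ae ?_
    filter_upwards [kernelOp_ae_eq μ hε f] with x hx
    rw [hx, smoothing_apply, inner_bumpLp, RCLike.inner_apply, ← integral_conj,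
      ← integral_const_mul]
    refine integral_congr_ae (ae_of_all _ fun y => ?_)
    simp only [map_mul, Complex.conj_ofReal]
    ring
  have h2 : ⟪f, kernelOp μ ε hε g⟫_ℂ
      = ∫ y, ∫ x, (bump ε x y : ℂ) * (g x * (starRingEnd ℂ) (f y)) ∂μ ∂μ := by
    rw [L2.inner_def]
    refine integral_congr_ae ?_
    filter_upwards [kernelOp_ae_eq μ hε g] with y hy
    rw [hy, smoothing_apply, inner_bumpLp, RCLike.inner_apply, ← integral_mul_const]
    refine integral_congr_ae (ae_of_all _ fun x => ?_)
    simp only [bump_comm ε x y]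
    ring
  refine h1.trans (Eq.trans ?_ h2.symm)
  exact integral_integral_swap hprod

/-- The operator is compact when `μ` lives on a totally bounded set `S`: up to a small error, the
image of `f` is determined by its values on a finite net in `S`. -/
theorem isCompactOperator_kernelOp {ε : ℝ} (hε : 0 < ε) {S : Set E} (hS : TotallyBounded S)
    (hμS : ∀ᵐ x ∂μ, x ∈ S) : IsCompactOperator (kernelOp μ ε hε) := by
  refine (isCompactOperator_iff_isCompact_closure_image_closedBall
    (kernelOp μ ε hε : Lp ℂ 2 μ →ₗ[ℂ] Lp ℂ 2 μ) zero_lt_one).2 ?_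
  refine TotallyBounded.isCompact_of_isClosed (TotallyBounded.closure ?_) isClosed_closure
  refine Metric.totallyBounded_of_finite_discretization fun δ hδ => ?_
  obtain ⟨s, hsf, hs⟩ := Metric.totallyBounded_iff.1 hS (ε * (δ / 8)) (by positivity)
  have : Fintype s := hsf.fintype
  have hball : TotallyBounded (Metric.closedBall (0 : s → ℂ) 1) :=
    (isCompact_closedBall _ _).totallyBounded
  obtain ⟨N, hNf, hN⟩ := Metric.totallyBounded_iff.1 hball (δ / 8) (by positivity)
  -- Discretize `f` by a point of the net `N` near the values of its smoothing on `s`.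
  let Φ : Lp ℂ 2 μ → s → ℂ := fun f i => smoothing μ ε hε f i
  have hΦ : ∀ f ∈ Metric.closedBall (0 : Lp ℂ 2 μ) 1, ∃ p ∈ N, dist (Φ f) p < δ / 8 := by
    intro f hf
    have hf1 : ‖f‖ ≤ 1 := by simpa using hf
    have : Φ f ∈ Metric.closedBall (0 : s → ℂ) 1 := by
      rw [mem_closedBall_zero_iff, pi_norm_le_iff_of_nonneg zero_le_one]
      intro i
      exact (norm_inner_bumpLp_le μ hε _ f).trans hf1
    obtain ⟨p, hp, hd⟩ := Set.mem_iUnion₂.1 (hN this)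
    exact ⟨p, hp, hd⟩
  have hpre : ∀ a : (kernelOp μ ε hε : Lp ℂ 2 μ →ₗ[ℂ] Lp ℂ 2 μ) '' Metric.closedBall 0 1,
      ∃ f ∈ Metric.closedBall (0 : Lp ℂ 2 μ) 1, kernelOp μ ε hε f = a := fun a => a.2
  choose G hG1 hG2 using hpre
  choose! P hPN hP using hΦ
  refine ⟨N, hNf.fintype, fun a => ⟨P (G a), hPN _ (hG1 a)⟩, fun a b hab => ?_⟩
  replace hab : P (G a) = P (G b) := congrArg Subtype.val hab
  have hfa := mem_closedBall_zero_iff.1 (hG1 a)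
  have hfb := mem_closedBall_zero_iff.1 (hG1 b)
  have hdist : dist (Φ (G a)) (Φ (G b)) < δ / 4 := by
    have h1 := hP _ (hG1 a)
    have h2 := hP _ (hG1 b)
    rw [hab] at h1
    linarith [dist_triangle_right (Φ (G a)) (Φ (G b)) (P (G b))]
  rw [← hG2 a, ← hG2 b, dist_eq_norm, ← map_sub]
  set h := G a - G b with hh
  have hh2 : ‖h‖ ≤ 2 := (norm_sub_le _ _).trans (by linarith)
  have hbound : ∀ᵐ x ∂μ, ‖kernelOp μ ε hε h x‖ ≤ δ / 2 := by
    filter_upwards [kernelOp_ae_eq μ hε h, hμS] with x hx hxS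
    obtain ⟨y, hy, hxy⟩ := Set.mem_iUnion₂.1 (hs hxS)
    have e1 : ‖smoothing μ ε hε h y‖ ≤ δ / 4 := by
      have := (dist_le_pi_dist (Φ (G a)) (Φ (G b)) ⟨y, hy⟩).trans hdist.le
      rw [dist_eq_norm] at this
      simpa [hh, Φ] using this
    have e2 : ‖smoothing μ ε hε h x - smoothing μ ε hε h y‖ ≤ δ / 4 := by
      rw [smoothing_apply, smoothing_apply, ← inner_sub_left]
      refine (norm_inner_le_norm (𝕜 := ℂ) (bumpLp μ ε hε x - bumpLp μ ε hε y) h).trans ?_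
      have e3 : ‖bumpLp μ ε hε x - bumpLp μ ε hε y‖ ≤ δ / 8 := by
        refine (norm_bumpLp_sub_le μ hε x y).trans ?_
        rw [div_le_iff₀ hε, mul_comm]
        exact (Metric.mem_ball.1 hxy).le
      calc _ ≤ δ / 8 * 2 := mul_le_mul e3 hh2 (norm_nonneg _) (by positivity)
        _ = δ / 4 := by ring
    rw [hx]
    have e4 := norm_add_le (smoothing μ ε hε h x - smoothing μ ε hε h y) (smoothing μ ε hε h y)
    rw [sub_add_cancel] at e4
    linarith
  have := Lp.norm_le_of_ae_bound (by positivity) hbound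
  simp [measureUnivNNReal] at this
  linarith

variable {T : Type*} [Group T] [MulAction T E] [IsIsometricSMul T E]

theorem kernelOp_smul [SMulInvariantMeasure T E μ] {ε : ℝ} (hε : 0 < ε) (t : T) (f : Lp ℂ 2 μ) :
    kernelOp μ ε hε (DomMulAct.mk t • f) = DomMulAct.mk t • kernelOp μ ε hε f := by
  have hb : ∀ x, DomMulAct.mk t • bumpLp μ ε hε (t • x) = bumpLp μ ε hε x := by
    intro x
    refine Lp.ext ?_
    refine (DomMulAct.smul_Lp_ae_eq _ _).trans ?_
    have h1 := BoundedContinuousFunction.coeFn_toLp 2 μ ℂ (bumpBCF ε hε x)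
    have h2 := (measurePreserving_smul t μ).quasiMeasurePreserving.ae
      (BoundedContinuousFunction.coeFn_toLp 2 μ ℂ (bumpBCF ε hε (t • x)))
    filter_upwards [h1, h2] with y hy1 hy2
    refine Eq.trans ?_ hy1.symm
    refine hy2.trans ?_
    exact congrArg Complex.ofReal (bump_smul_smul ε t x y)
  have hs : ∀ x, smoothing μ ε hε (DomMulAct.mk t • f) x = smoothing μ ε hε f (t • x) := by
    intro x
    rw [smoothing_apply, smoothing_apply, ← hb x]
    exact LinearIsometry.inner_map_map (𝕜 := ℂ) (Lp.compMeasurePreservingₗᵢ ℂ (fun y : E => t • y)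
      (measurePreserving_smul t μ) : Lp ℂ 2 μ →ₗᵢ[ℂ] Lp ℂ 2 μ) (bumpLp μ ε hε (t • x)) f
  refine Lp.ext ((kernelOp_ae_eq μ hε _).trans
    (EventuallyEq.trans ?_ (DomMulAct.smul_Lp_ae_eq _ _).symm))
  filter_upwards [(measurePreserving_smul t μ).quasiMeasurePreserving.ae (kernelOp_ae_eq μ hε f)]
    with x hx
  rw [hs x]
  exact hx.symm

/-- The span of the finite-dimensional invariant subspaces of `L²`. -/
def finiteDimensionalPart (T : Type*) {X : Type*} [MeasurableSpace X] [Group T] [MulAction T X]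
    [MeasurableConstSMul T X] (μ : Measure X) [SMulInvariantMeasure T X μ] :
    Submodule ℂ (Lp ℂ 2 μ) :=
  ⨆ V ∈ {V : Submodule ℂ (Lp ℂ 2 μ) | FiniteDimensional ℂ V ∧
      ∀ (t : T), ∀ f ∈ V, DomMulAct.mk t • f ∈ V}, V

theorem le_finiteDimensionalPart {X : Type*} [MeasurableSpace X] [MulAction T X]
    [MeasurableConstSMul T X] {μ : Measure X} [SMulInvariantMeasure T X μ]
    {V : Submodule ℂ (Lp ℂ 2 μ)} (hV : FiniteDimensional ℂ V)
    (hVT : ∀ (t : T), ∀ f ∈ V, DomMulAct.mk t • f ∈ V) : V ≤ finiteDimensionalPart T μ :=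
  le_iSup₂_of_le V ⟨hV, hVT⟩ le_rfl

/-- By the spectral theorem the range of a compact self-adjoint operator is spanned by its
eigenspaces with nonzero eigenvalue; these are finite-dimensional, and invariant if the operator
commutes with the action. -/
theorem apply_mem_closure_finiteDimensionalPart {X : Type*} [MeasurableSpace X] [MulAction T X]
    [MeasurableConstSMul T X] {μ : Measure X} [SMulInvariantMeasure T X μ]
    {A : Lp ℂ 2 μ →L[ℂ] Lp ℂ 2 μ} (hA : IsCompactOperator A)
    (hsymm : (A : Lp ℂ 2 μ →ₗ[ℂ] Lp ℂ 2 μ).IsSymmetric)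
    (hAT : ∀ (t : T) (f : Lp ℂ 2 μ), A (DomMulAct.mk t • f) = DomMulAct.mk t • A f)
    (f : Lp ℂ 2 μ) : A f ∈ (finiteDimensionalPart T μ).topologicalClosure := by
  have hdense := ContinuousLinearMap.orthogonalComplement_iSup_eigenspaces_eq_bot hA hsymm
  rw [← Submodule.topologicalClosure_eq_top_iff] at hdense
  have hle : (⨆ c, Module.End.eigenspace (A : Module.End ℂ (Lp ℂ 2 μ)) c) ≤
      (finiteDimensionalPart T μ).topologicalClosure.comap (A : Lp ℂ 2 μ →ₗ[ℂ] Lp ℂ 2 μ) := by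
    refine iSup_le fun c g hg => ?_
    have hg' : A g = c • g := Module.End.mem_eigenspace_iff.1 hg
    rw [Submodule.mem_comap]
    change A g ∈ _
    rw [hg']
    -- For `c = 0` the vector `A g = 0` is trivially in the span.
    rcases eq_or_ne c 0 with rfl | hc
    · simp
    refine Submodule.smul_mem _ _ (Submodule.le_topologicalClosure _ ?_)
    refine le_finiteDimensionalPart
      (ContinuousLinearMap.finite_dimensional_eigenspace hA c hc) (fun t h hh => ?_) hg
    have hh' : A h = c • h := Module.End.mem_eigenspace_iff.1 hh
    refine Module.End.mem_eigenspace_iff.2 ?_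
    change A _ = _
    rw [hAT, hh', smul_comm]
  have hcl := Submodule.topologicalClosure_minimal _ hle
    ((Submodule.isClosed_topologicalClosure _).preimage A.continuous)
  rw [hdense] at hcl
  exact hcl (Submodule.mem_top (x := f))

theorem hasDiscreteSpectrum_of_isometric [SecondCountableTopology E] [ErgodicSMul T E μ] :
    HasDiscreteSpectrum T E μ := by
  change (finiteDimensionalPart T μ).topologicalClosure = ⊤
  rw [Submodule.topologicalClosure_eq_top_iff, Submodule.eq_bot_iff]
  intro h hh
  obtain ⟨x₀, hx₀⟩ : μ.support.Nonempty :=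
    Measure.nonempty_support (IsProbabilityMeasure.ne_zero μ)
  have hcl := closure_orbit_eq_support (T := T) hx₀
  have htb : TotallyBounded μ.support := by
    rw [← hcl]
    exact (totallyBounded_orbit_of_mem_support (T := T) hx₀).closure
  have hae : ∀ᵐ x ∂μ, x ∈ μ.support := Measure.support_mem_ae
  have hhi : Integrable h μ := (Lp.memLp h).integrable one_le_two
  have horth : ∀ g : BoundedContinuousFunction E ℂ,
      ⟪h, BoundedContinuousFunction.toLp 2 μ ℂ g⟫_ℂ = 0 := by
    intro g
    set G := BoundedContinuousFunction.toLp 2 μ ℂ g with hG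
    have hGae : G =ᵐ[μ] g := BoundedContinuousFunction.coeFn_toLp 2 μ ℂ g
    let ε : ℕ → ℝ := fun n => 1 / ((n : ℝ) + 1)
    have hε : ∀ n, 0 < ε n := fun n => Nat.one_div_pos_of_nat
    have hzero : ∀ n, ⟪h, kernelOp μ (ε n) (hε n) G⟫_ℂ = 0 := by
      intro n
      refine Submodule.inner_left_of_mem_orthogonal
        (K := (finiteDimensionalPart T μ).topologicalClosure) ?_ ?_
      · exact apply_mem_closure_finiteDimensionalPart
          (isCompactOperator_kernelOp μ (hε n) htb hae) (isSymmetric_kernelOp μ (hε n))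
          (fun t f => kernelOp_smul μ (hε n) t f) G
      · rwa [Submodule.orthogonal_closure]
    let c : ℕ → ℝ := fun n => bumpMass μ (ε n) x₀
    have hc : ∀ n, 0 < c n := fun n => bumpMass_pos (hε n) hx₀
    have hcx : ∀ n, ∀ x ∈ μ.support, bumpMass μ (ε n) x = c n := fun n x hx =>
      bumpMass_eq_of_mem_closure_orbit (T := T) (hε n) μ (by rwa [hcl])
    -- The normalized smoothings of `g` are orthogonal to `h`, bounded, and converge to `g`
    -- pointwise on the support.
    let w : ℕ → E → ℂ := fun n x => (c n : ℂ)⁻¹ * smoothing μ (ε n) (hε n) G x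
    have hw : ∀ n x, x ∈ μ.support → ∀ δ : ℝ, (∀ y, dist x y < ε n → ‖g y - g x‖ ≤ δ) →
        ‖w n x - g x‖ ≤ δ := by
      intro n x hx δ hδ
      have hcn : (c n : ℂ) ≠ 0 := by exact_mod_cast (hc n).ne'
      have hb := integrable_bump (hε n) μ x
      have hbC : Integrable (fun y => (bump (ε n) x y : ℂ)) μ := hb.ofReal
      have hbg : Integrable (fun y => (bump (ε n) x y : ℂ) * g y) μ :=
        (g.integrable μ).bdd_mul (c := 1) hbC.aestronglyMeasurable
          (ae_of_all _ fun y => by rw [Complex.norm_real]; exact norm_bump_le_one (hε n) _ _)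
      have e1 : smoothing μ (ε n) (hε n) G x = ∫ y, (bump (ε n) x y : ℂ) * g y ∂μ := by
        rw [smoothing_apply, inner_bumpLp]
        refine integral_congr_ae ?_
        filter_upwards [hGae] with y hy
        rw [hy]
      have e2 : (c n : ℂ) * g x = ∫ y, (bump (ε n) x y : ℂ) * g x ∂μ := by
        rw [integral_mul_const, integral_complex_ofReal, ← hcx n x hx]
        rfl
      have e3 : (c n : ℂ) * (w n x - g x) = ∫ y, (bump (ε n) x y : ℂ) * (g y - g x) ∂μ := by
        rw [mul_sub, mul_inv_cancel_left₀ hcn, e1, e2]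
        refine (integral_sub hbg (hbC.mul_const _)).symm.trans ?_
        simp only [mul_sub]
      have e4 : c n * ‖w n x - g x‖ ≤ c n * δ := by
        have : ‖(c n : ℂ) * (w n x - g x)‖ = c n * ‖w n x - g x‖ := by
          rw [norm_mul, Complex.norm_real, Real.norm_of_nonneg (hc n).le]
        rw [← this, e3]
        have e5 : c n * δ = ∫ y, bump (ε n) x y * δ ∂μ := by
          rw [integral_mul_const, ← hcx n x hx]
          rfl
        rw [e5]
        refine norm_integral_le_of_norm_le (hb.mul_const δ) (ae_of_all _ fun y => ?_)
        rw [norm_mul, Complex.norm_real, Real.norm_of_nonneg (bump_nonneg _ _ _)]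
        by_cases h0 : bump (ε n) x y = 0
        · simp [h0]
        · exact mul_le_mul_of_nonneg_left (hδ y (dist_lt_of_bump_ne_zero (hε n) h0))
            (bump_nonneg _ _ _)
      exact le_of_mul_le_mul_left e4 (hc n)
    have hint : ∀ n, ∫ x, w n x * (starRingEnd ℂ) (h x) ∂μ = 0 := by
      intro n
      have : ∫ x, w n x * (starRingEnd ℂ) (h x) ∂μ
          = (c n : ℂ)⁻¹ * ⟪h, kernelOp μ (ε n) (hε n) G⟫_ℂ := by
        rw [L2.inner_def, ← integral_const_mul]
        refine integral_congr_ae ?_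
        filter_upwards [kernelOp_ae_eq μ (hε n) G] with x hx
        rw [hx, RCLike.inner_apply, mul_assoc]
      rw [this, hzero n, mul_zero]
    have hlim : Tendsto (fun n => ∫ x, w n x * (starRingEnd ℂ) (h x) ∂μ) atTop
        (𝓝 (∫ x, g x * (starRingEnd ℂ) (h x) ∂μ)) := by
      refine tendsto_integral_of_dominated_convergence (fun x => 3 * ‖g‖ * ‖h x‖) ?_ ?_ ?_ ?_
      · intro n
        refine AEStronglyMeasurable.mul ?_
          (RCLike.continuous_conj.comp_aestronglyMeasurable hhi.aestronglyMeasurable)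
        exact (continuous_const.mul
          (smoothing μ (ε n) (hε n) G).continuous).measurable.aestronglyMeasurable
      · exact hhi.norm.const_mul _
      · intro n
        filter_upwards [hae] with x hx
        rw [norm_mul, RCLike.norm_conj]
        gcongr
        have := hw n x hx (2 * ‖g‖) fun y _ => by
          refine (norm_sub_le _ _).trans ?_
          linarith [g.norm_coe_le_norm x, g.norm_coe_le_norm y]
        have h3 := norm_add_le (w n x - g x) (g x)
        rw [sub_add_cancel] at h3
        linarith [g.norm_coe_le_norm x]
      · filter_upwards [hae] with x hx
        refine Tendsto.mul_const _ ?_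
        rw [Metric.tendsto_atTop]
        intro δ hδ
        obtain ⟨r, hr, hgr⟩ := Metric.continuousAt_iff.1
          (g.continuous.continuousAt (x := x)) (δ / 2) (half_pos hδ)
        obtain ⟨N, hN⟩ := exists_nat_one_div_lt hr
        refine ⟨N, fun n hn => ?_⟩
        rw [dist_eq_norm]
        have hεn : ε n ≤ ε N := Nat.one_div_le_one_div hn
        refine (hw n x hx (δ / 2) fun y hy => ?_).trans_lt (half_lt_self hδ)
        rw [← dist_eq_norm]
        refine (hgr ?_).le
        rw [dist_comm]
        exact hy.trans (hεn.trans_lt hN)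
    simp only [hint] at hlim
    have hz := tendsto_nhds_unique hlim tendsto_const_nhds
    rw [L2.inner_def, ← hz]
    refine integral_congr_ae ?_
    filter_upwards [hGae] with x hx
    rw [hx, RCLike.inner_apply]
  have hdr := BoundedContinuousFunction.toLp_denseRange (α := E) ℂ μ ℂ (p := 2) (by simp)
  have hall : ∀ k : Lp ℂ 2 μ, ⟪h, k⟫_ℂ = 0 := fun k =>
    hdr.induction_on k (isClosed_eq (continuous_const.inner continuous_id) continuous_const) horth
  exact inner_self_eq_zero.1 (hall h)

end Spectrum

/-- `L²` depends only on the Borel structure, which is the same for both topologies. -/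
theorem IsVeechSystem.hasDiscreteSpectrum {T : Type v} {X : Type u} [Group T] [TopologicalSpace X]
    [MeasurableSpace X] [BorelSpace X] [MulAction T X] [MeasurableConstSMul T X]
    (hX : IsVeechSystem T X) (μ : Measure X) [IsProbabilityMeasure μ] [ErgodicSMul T X μ] :
    HasDiscreteSpectrum T X μ := by
  obtain ⟨d, hd⟩ := hX
  exact @hasDiscreteSpectrum_of_isometric X d _ hd.borelSpace μ _ T _ _ hd.isIsometricSMul
    hd.secondCountableTopology _

/-! ### Equicontinuous systems and proximality -/

section Equicontinuous

theorem isEquicontinuousSystem_of_isometric {T : Type*} {K : Type*} [Group T] [MetricSpace K]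
    [MulAction T K] [IsIsometricSMul T K] : IsEquicontinuousSystem T K := by
  have h : ∀ t : T, LipschitzWith 1 (fun x : K => t • x) := fun t => (isometry_smul K t).lipschitz
  exact (LipschitzWith.uniformEquicontinuous _ 1 h).equicontinuous

variable {T : Type*} [Group T]

theorem Proximal.eq_of_isEquicontinuousSystem {N : Type*} [UniformSpace N] [CompactSpace N]
    [T2Space N] [MulAction T N] (hN : IsEquicontinuousSystem T N) {x y : N}
    (h : Proximal T x y) : x = y := by
  obtain ⟨F, z, hF, hx, hy⟩ := h
  have hU := CompactSpace.uniformEquicontinuous_of_equicontinuous hN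
  refine eq_of_uniformity fun {V} hV => ?_
  have h1 : ∀ᶠ p : N × N in uniformity N, ∀ t : T, (t • p.1, t • p.2) ∈ V := hU V hV
  have h2 : Tendsto (fun t : T => (t • x, t • y)) F (uniformity N) :=
    (hx.prodMk_nhds hy).mono_right (nhds_le_uniformity z)
  obtain ⟨t, ht⟩ := (h2.eventually h1).exists
  simpa using ht t⁻¹

theorem Proximal.map {M N : Type*} [TopologicalSpace M] [TopologicalSpace N] [MulAction T M]
    [MulAction T N] {π : M → N} (hπ : IsFactorMap T π) {x y : M} (h : Proximal T x y) :
    Proximal T (π x) (π y) := by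
  obtain ⟨F, z, hF, hx, hy⟩ := h
  refine ⟨F, π z, hF, ?_, ?_⟩
  · simpa only [hπ.map_smul, Function.comp_def] using (hπ.continuous.tendsto z).comp hx
  · simpa only [hπ.map_smul, Function.comp_def] using (hπ.continuous.tendsto z).comp hy

end Equicontinuous

/-! ### The isometric factor of a minimal system -/

section Factor

variable {T : Type v} [Group T]
  {S : Type u} [MetricSpace S] [MulAction T S]
  {K : Type u} [MetricSpace K] [CompactSpace K] [MulAction T K] [IsIsometricSMul T K]
  {X : Type u} [TopologicalSpace X] [CompactSpace X] [T2Space X] [MulAction T X]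
  [ContinuousConstSMul T X]

/-- The closure in `K × X` of the set of pairs `(ι s, h s)`. -/
def jointClosure (ι : S → K) (h : S → X) : Set (K × X) :=
  closure (Set.range fun s => (ι s, h s))

variable {ι : S → K} {h : S → X}

omit [MetricSpace S] [CompactSpace K] [CompactSpace X] [T2Space X] in
theorem mk_mem_jointClosure (s : S) : (ι s, h s) ∈ jointClosure ι h := subset_closure ⟨s, rfl⟩

omit [CompactSpace K] [CompactSpace X] in
/-- Points of `ι S` have only one partner in `X`, by continuity of `h` on `S`. -/
theorem eq_of_mem_jointClosure (hι : Isometry ι) (hh : Continuous h) {s : S} {x : X}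
    (hx : (ι s, x) ∈ jointClosure ι h) : x = h s := by
  obtain ⟨F, hF, hFx⟩ := mem_closure_iff_ultrafilter.1 hx
  have hne : (comap (fun s : S => (ι s, h s)) (F : Filter (K × X))).NeBot :=
    F.neBot.comap_of_range_mem hF
  have hlim : Tendsto (fun s : S => (ι s, h s))
      (comap (fun s : S => (ι s, h s)) (F : Filter (K × X))) (𝓝 (ι s, x)) :=
    tendsto_comap.mono_right hFx
  have h1 : Tendsto ι (comap (fun s : S => (ι s, h s)) (F : Filter (K × X))) (𝓝 (ι s)) :=
    (continuous_fst.tendsto _).comp hlim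
  have h2 : Tendsto h (comap (fun s : S => (ι s, h s)) (F : Filter (K × X))) (𝓝 x) :=
    (continuous_snd.tendsto _).comp hlim
  have h3 := hι.isEmbedding.isInducing.tendsto_nhds_iff.2 h1
  exact tendsto_nhds_unique h2 ((hh.tendsto s).comp h3)

omit [MetricSpace S] [CompactSpace K] [CompactSpace X] [T2Space X] in
theorem smul_mem_jointClosure (hιT : ∀ (t : T) (s : S), ι (t • s) = t • ι s)
    (hhT : ∀ (t : T) (s : S), h (t • s) = t • h s) (t : T) {p : K × X}
    (hp : p ∈ jointClosure ι h) : t • p ∈ jointClosure ι h := by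
  refine map_mem_closure (continuous_const_smul t) hp ?_
  rintro _ ⟨s, rfl⟩
  exact ⟨t • s, by simp [hιT, hhT]⟩

omit [MetricSpace S] [MulAction T K] [IsIsometricSMul T K] [CompactSpace X] [T2Space X]
  [ContinuousConstSMul T X] in
theorem exists_mem_jointClosure [Nonempty S] [MulAction.IsMinimal T X]
    (hhT : ∀ (t : T) (s : S), h (t • s) = t • h s) (x : X) :
    ∃ k : K, (k, x) ∈ jointClosure ι h := by
  obtain ⟨s⟩ := ‹Nonempty S›
  have hcl : IsClosed (Prod.snd '' jointClosure ι h) :=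
    isClosedMap_snd_of_compactSpace _ isClosed_closure
  have hsub : MulAction.orbit T (h s) ⊆ Prod.snd '' jointClosure ι h := by
    rintro _ ⟨t, rfl⟩
    exact ⟨_, mk_mem_jointClosure (t • s), hhT t s⟩
  obtain ⟨p, hp, rfl⟩ := closure_minimal hsub hcl (MulAction.dense_orbit T (h s) x)
  exact ⟨p.1, hp⟩

variable [MeasurableSpace S] [BorelSpace S] [StandardBorelSpace S] [MeasurableSpace K]
  [BorelSpace K] [MulAction.IsMinimal T K]

omit [CompactSpace K] [MulAction T K] [IsIsometricSMul T K] [MulAction.IsMinimal T K] in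
/-- The Lusin–Souslin theorem makes `ι` a Borel isomorphism onto a Borel set. -/
theorem measurableEmbedding_of_isometry [SecondCountableTopology K] (hι : Isometry ι) :
    MeasurableEmbedding ι :=
  hι.continuous.measurable.measurableEmbedding hι.injective

/-- `K` has only one invariant probability measure, the image of the one on `S`; so every
invariant probability measure of `K` is carried by the image of `S`. -/
theorem ae_mem_range_of_invariant (m : Measure S) [IsProbabilityMeasure m]
    [SMulInvariantMeasure T S m] (hι : Isometry ι) (hιT : ∀ (t : T) (s : S), ι (t • s) = t • ι s)
    (ν : Measure K) [IsProbabilityMeasure ν] [SMulInvariantMeasure T K ν] :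
    ∀ᵐ k ∂ν, k ∈ Set.range ι := by
  have hιm := measurableEmbedding_of_isometry hι
  have h1 : SMulInvariantMeasure T K (m.map ι) := smulInvariantMeasure_map m ι hιT hιm.measurable
  have h2 : IsProbabilityMeasure (m.map ι) :=
    Measure.isProbabilityMeasure_map hιm.measurable.aemeasurable
  rw [invariant_measure_unique_of_isMinimal (T := T) ν (m.map ι)]
  exact (hιm.ae_map_iff).2 (ae_of_all _ fun s => ⟨s, rfl⟩)

/-- The set of `(k, k', x)` with both `(k, x)` and `(k', x)` in the joint closure and with
`dist k k' = c`, as an invariant set. -/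
def fiberPairs (hιT : ∀ (t : T) (s : S), ι (t • s) = t • ι s)
    (hhT : ∀ (t : T) (s : S), h (t • s) = t • h s) (c : ℝ) : SubMulAction T (K × K × X) where
  carrier := {p | (p.1, p.2.2) ∈ jointClosure ι h ∧ (p.2.1, p.2.2) ∈ jointClosure ι h ∧
    dist p.1 p.2.1 = c}
  smul_mem' t p hp := ⟨smul_mem_jointClosure hιT hhT t hp.1,
    smul_mem_jointClosure hιT hhT t hp.2.1, (dist_smul t p.1 p.2.1).trans hp.2.2⟩

/-- Points of `X` have only one partner in `K`. If `k` and `k'` are partners of `x`, then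
amenability yields an invariant measure on the triples `(k, k', x)` with the given value of
`dist k k'`. Almost surely `k` and `k'` are in `ι S`, so that `x` determines both of them. -/
theorem eq_of_mem_jointClosure_of_mem_jointClosure (m : Measure S) [IsProbabilityMeasure m]
    [SMulInvariantMeasure T S m] (hT : IsAmenable T) [SecondCountableTopology X]
    (hι : Isometry ι) (hιT : ∀ (t : T) (s : S), ι (t • s) = t • ι s) (hh : Continuous h)
    (hhi : Function.Injective h) (hhT : ∀ (t : T) (s : S), h (t • s) = t • h s) {k k' : K} {x : X}
    (hk : (k, x) ∈ jointClosure ι h) (hk' : (k', x) ∈ jointClosure ι h) : k = k' := by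
  borelize X
  set R := fiberPairs hιT hhT (dist k k') with hR
  have hcl : IsClosed (R : Set (K × K × X)) := by
    refine IsClosed.inter ?_ (IsClosed.inter ?_ ?_)
    · exact isClosed_closure.preimage (f := fun p : K × K × X => (p.1, p.2.2)) (by fun_prop)
    · exact isClosed_closure.preimage (f := fun p : K × K × X => (p.2.1, p.2.2)) (by fun_prop)
    · exact isClosed_eq (by fun_prop) continuous_const
  have : CompactSpace R := isCompact_iff_compactSpace.1 hcl.isCompact
  have : Nonempty R := ⟨⟨(k, k', x), hk, hk', rfl⟩⟩
  have : ContinuousConstSMul T R := ⟨fun t => by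
    refine Continuous.subtype_mk ?_ _
    fun_prop⟩
  have : SecondCountableTopology R :=
    TopologicalSpace.Subtype.secondCountableTopology (R : Set (K × K × X))
  obtain ⟨l, hl, hlT⟩ := hT.exists_invariant_measure (X := R)
  -- Both projections to `K` send the measure to the invariant measure of `K`.
  have key : ∀ f : R → K, Measurable f → (∀ (t : T) (p : R), f (t • p) = t • f p) →
      ∀ᵐ p ∂l, f p ∈ Set.range ι := by
    intro f hf hfT
    have h1 := smulInvariantMeasure_map l f hfT hf
    have h2 := Measure.isProbabilityMeasure_map (μ := l) hf.aemeasurable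
    exact ae_of_ae_map hf.aemeasurable (ae_mem_range_of_invariant m hι hιT (l.map f))
  have ha := key (fun p => p.1.1) (by fun_prop) fun t p => rfl
  have hb := key (fun p => p.1.2.1) (by fun_prop) fun t p => rfl
  obtain ⟨⟨⟨a, b, y⟩, hay, hby, hab⟩, ⟨s, hs⟩, ⟨s', hs'⟩⟩ := (ha.and hb).exists
  simp only at hs hs' hay hby hab
  subst hs hs'
  have := (eq_of_mem_jointClosure hι hh hay).symm.trans (eq_of_mem_jointClosure hι hh hby)
  rw [hhi this, dist_self] at hab
  exact dist_eq_zero.1 hab.symm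

/-- The joint closure is the graph of a factor map from `X` onto `K`, which is injective over
`ι S`. -/
theorem exists_isometric_factor (m : Measure S) [IsProbabilityMeasure m]
    [SMulInvariantMeasure T S m] (hT : IsAmenable T) [SecondCountableTopology X]
    [MulAction.IsMinimal T X]
    (hι : Isometry ι) (hιT : ∀ (t : T) (s : S), ι (t • s) = t • ι s) (hh : Continuous h)
    (hhi : Function.Injective h) (hhT : ∀ (t : T) (s : S), h (t • s) = t • h s) :
    ∃ π : X → K, IsFactorMap T π ∧ (∀ s, π (h s) = ι s) ∧ ∀ x s, π x = ι s → x = h s := by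
  have hne : Nonempty S := (nonempty_of_isProbabilityMeasure m)
  choose π hπ using exists_mem_jointClosure (T := T) (ι := ι) hhT
  have huniq : ∀ {k x}, (k, x) ∈ jointClosure ι h → π x = k := fun hk =>
    eq_of_mem_jointClosure_of_mem_jointClosure m hT hι hιT hh hhi hhT (hπ _) hk
  have hcont : Continuous π := by
    refine continuous_iff_isClosed.2 fun C hC => ?_
    have : π ⁻¹' C = Prod.snd '' (jointClosure ι h ∩ Prod.fst ⁻¹' C) := by
      ext x
      constructor
      · exact fun hx => ⟨(π x, x), ⟨hπ x, hx⟩, rfl⟩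
      · rintro ⟨⟨k, x⟩, ⟨hk, hkC⟩, rfl⟩
        rw [Set.mem_preimage, huniq hk]
        exact hkC
    rw [this]
    exact isClosedMap_snd_of_compactSpace _
      (isClosed_closure.inter (hC.preimage continuous_fst))
  have hsmul : ∀ (t : T) (x : X), π (t • x) = t • π x := fun t x =>
    huniq (smul_mem_jointClosure hιT hhT t (hπ x))
  refine ⟨π, ⟨hcont, ?_, hsmul⟩, fun s => huniq (mk_mem_jointClosure s), fun x s hx => ?_⟩
  · have hrange : IsClosed (Set.range π) := (isCompact_range hcont).isClosed
    have hdense : Dense (Set.range π) := by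
      obtain ⟨s⟩ := hne
      refine (MulAction.dense_orbit T (π (h s))).mono ?_
      rintro _ ⟨t, rfl⟩
      exact ⟨t • h s, hsmul t _⟩
    exact Set.range_eq_univ.1 (hrange.closure_eq ▸ hdense.closure_eq)
  · exact eq_of_mem_jointClosure hι hh (hx ▸ hπ x)

omit [MetricSpace S] [MulAction T S] [CompactSpace K] [IsIsometricSMul T K] [T2Space X]
  [ContinuousConstSMul T X] [MeasurableSpace S] [BorelSpace S] [StandardBorelSpace S]
  [MeasurableSpace K] [BorelSpace K] in
/-- Points in the same fibre of the factor map are proximal: move their common image to a point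
over which the fibre is a singleton. -/
theorem proximal_of_factor_eq [Nonempty S] {π : X → K} (hπ : IsFactorMap T π)
    (hπi : ∀ x s, π x = ι s → x = h s) {x y : X} (hxy : π x = π y) : Proximal T x y := by
  obtain ⟨s⟩ := ‹Nonempty S›
  obtain ⟨F, hF, hFs⟩ := mem_closure_iff_ultrafilter.1 (MulAction.dense_orbit T (π x) (ι s))
  have hne : (comap (fun t : T => t • π x) (F : Filter K)).NeBot := F.neBot.comap_of_range_mem hF
  have hlim : Tendsto (fun t : T => t • π x) (comap (fun t : T => t • π x) (F : Filter K))
      (𝓝 (ι s)) := tendsto_comap.mono_right hFs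
  -- Along an ultrafilter every orbit converges, and over `ι s` there is only the limit `h s`.
  set U := Ultrafilter.of (comap (fun t : T => t • π x) (F : Filter K)) with hU
  have hlimU : Tendsto (fun t : T => t • π x) U (𝓝 (ι s)) := hlim.mono_left (Ultrafilter.of_le _)
  have key : ∀ z : X, π z = π x → Tendsto (fun t : T => t • z) U (𝓝 (h s)) := by
    intro z hz
    obtain ⟨w, -, hw⟩ := isCompact_univ.ultrafilter_le_nhds (U.map fun t : T => t • z)
      (by simp)
    have hw' : Tendsto (fun t : T => t • z) U (𝓝 w) := hw
    have h1 : Tendsto (fun t : T => t • π x) U (𝓝 (π w)) := by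
      have := (hπ.continuous.tendsto w).comp hw'
      simpa only [Function.comp_def, hπ.map_smul, hz] using this
    rwa [← hπi w s (tendsto_nhds_unique h1 hlimU)]
  exact ⟨U, h s, U.neBot, key x rfl, key y hxy.symm⟩

omit [MetricSpace S] [MulAction T S] [CompactSpace K] [T2Space X] [ContinuousConstSMul T X]
  [MeasurableSpace S] [BorelSpace S] [StandardBorelSpace S] [MeasurableSpace K] [BorelSpace K] in
theorem isMaximalEquicontinuousFactor_of_factor [Nonempty S] {π : X → K} (hπ : IsFactorMap T π)
    (hπi : ∀ x s, π x = ι s → x = h s) : IsMaximalEquicontinuousFactor T π where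
  isFactorMap := hπ
  equicontinuous := isEquicontinuousSystem_of_isometric
  universal N' _ _ _ _ _ π' hπ' hN' := by
    have hq : IsQuotientMap π :=
      hπ.continuous.isClosedMap.isQuotientMap hπ.continuous hπ.surjective
    have hconst : ∀ x y, π x = π y → π' x = π' y := fun x y hxy =>
      ((proximal_of_factor_eq (T := T) hπ hπi hxy).map hπ').eq_of_isEquicontinuousSystem hN'
    have hcomp : ∀ x, π' (Function.surjInv hπ.surjective (π x)) = π' x := fun x =>
      hconst _ _ (Function.surjInv_eq hπ.surjective _)
    refine ⟨fun k => π' (Function.surjInv hπ.surjective k), ⟨?_, ?_, ?_⟩, ?_⟩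
    · refine hq.continuous_iff.2 ?_
      simpa only [Function.comp_def, hcomp] using hπ'.continuous
    · intro n
      obtain ⟨x, rfl⟩ := hπ'.surjective n
      exact ⟨π x, hcomp x⟩
    · intro t k
      obtain ⟨x, rfl⟩ := hπ.surjective k
      rw [← hπ.map_smul, hcomp, hcomp, hπ'.map_smul]
    · ext x
      exact (hcomp x).symm

omit [CompactSpace X] [T2Space X] in
theorem isIsomorphicExtension_of_factor (m : Measure S) [IsProbabilityMeasure m]
    [SMulInvariantMeasure T S m] [MeasurableSpace X] [BorelSpace X]
    (hι : Isometry ι) (hιT : ∀ (t : T) (s : S), ι (t • s) = t • ι s) (hh : Continuous h)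
    (hhT : ∀ (t : T) (s : S), h (t • s) = t • h s) {π : X → K} (hπ : IsFactorMap T π)
    (hπh : ∀ s, π (h s) = ι s) (hπi : ∀ x s, π x = ι s → x = h s) :
    IsIsomorphicExtension T π := by
  have hιm := measurableEmbedding_of_isometry hι
  have hne : Nonempty S := nonempty_of_isProbabilityMeasure m
  -- `g` is a Borel extension to `K` of the inverse of `π` over `ι S`.
  obtain ⟨g, hg, hgι⟩ := hιm.exists_measurable_extend hh.measurable
    fun _ => hne.map h
  have hgι' : ∀ s, g (ι s) = h s := congrFun hgι
  have hπm : Measurable π := hπ.continuous.measurable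
  have hrange : ∀ μ : Measure X, IsProbabilityMeasure μ → SMulInvariantMeasure T X μ →
      ∀ᵐ y ∂(μ.map π), y ∈ Set.range ι := by
    intro μ h1 h2
    have h3 := smulInvariantMeasure_map μ π hπ.map_smul hπm
    have h4 := Measure.isProbabilityMeasure_map (μ := μ) hπm.aemeasurable
    exact ae_mem_range_of_invariant m hι hιT (μ.map π)
  have hinv : ∀ μ : Measure X, IsProbabilityMeasure μ → SMulInvariantMeasure T X μ →
      ∀ᵐ x ∂μ, g (π x) = x := by
    intro μ h1 h2
    filter_upwards [ae_of_ae_map hπm.aemeasurable (hrange μ h1 h2)] with x hx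
    obtain ⟨s, hs⟩ := hx
    rw [← hs, hgι', hπi x s hs.symm]
  have hιT' := smulInvariantMeasure_map m ι hιT hιm.measurable
  have hιp := Measure.isProbabilityMeasure_map (μ := m) hιm.measurable.aemeasurable
  refine ⟨hπ, ⟨m.map h, ⟨?_, ?_⟩, ?_⟩, ⟨m.map ι, ⟨hιp, hιT'⟩, ?_⟩, fun μ h1 h2 => ⟨g, hg, ?_, ?_⟩⟩
  · exact Measure.isProbabilityMeasure_map hh.measurable.aemeasurable
  · exact smulInvariantMeasure_map m h hhT hh.measurable
  · rintro μ ⟨h1, h2⟩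
    have h3 := smulInvariantMeasure_map μ π hπ.map_smul hπm
    have h4 := Measure.isProbabilityMeasure_map (μ := μ) hπm.aemeasurable
    calc μ = μ.map id := Measure.map_id.symm
      _ = μ.map (g ∘ π) := Measure.map_congr ((hinv μ h1 h2).mono fun x hx => hx.symm)
      _ = (μ.map π).map g := (Measure.map_map hg hπm).symm
      _ = (m.map ι).map g := by
        rw [invariant_measure_unique_of_isMinimal (T := T) (μ.map π) (m.map ι)]
      _ = m.map h := by rw [Measure.map_map hg hιm.measurable, hgι]
  · rintro ν ⟨h1, h2⟩
    exact invariant_measure_unique_of_isMinimal (T := T) ν (m.map ι)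
  · exact hinv μ h1 h2
  · filter_upwards [hrange μ h1 h2] with y hy
    obtain ⟨s, rfl⟩ := hy
    rw [hgι', hπh]

end Factor

/-! ### Minimal Veech systems of amenable groups -/

section Minimal

theorem standardBorelSpace_of_measurableEquiv {E X : Type*} [MeasurableSpace E]
    [TopologicalSpace X] [PolishSpace X] [MeasurableSpace X] [BorelSpace X] (j : E ≃ᵐ X) :
    StandardBorelSpace E := by
  refine ⟨⟨TopologicalSpace.induced j inferInstance, ?_, ?_⟩⟩
  · refine @BorelSpace.mk _ (_) _ ?_
    rw [borel_comap, ← BorelSpace.measurable_eq (α := X)]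
    exact j.measurableEmbedding.comap_eq.symm
  · exact j.toEquiv.polishSpace_induced

theorem isIsometricSMul_subMulAction {T E : Type*} [Group T] [MetricSpace E] [MulAction T E]
    [IsIsometricSMul T E] (S : SubMulAction T E) : IsIsometricSMul T S :=
  ⟨fun t x y => edist_smul_left t (x : E) y⟩

theorem isIsometricSMul_completion {T S : Type*} [Group T] [MetricSpace S] [MulAction T S]
    [IsIsometricSMul T S] : IsIsometricSMul T (UniformSpace.Completion S) :=
  ⟨fun t => (isometry_smul S t).completion_map⟩

/-- An isometric action that is minimal on a dense subset is minimal. -/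
theorem isMinimal_of_denseRange_isometry {T S K : Type*} [Group T] [MetricSpace S] [MulAction T S]
    [MulAction.IsMinimal T S] [MetricSpace K] [MulAction T K] [IsIsometricSMul T K] {ι : S → K}
    (hι : Isometry ι) (hιd : DenseRange ι) (hιT : ∀ (t : T) (s : S), ι (t • s) = t • ι s) :
    MulAction.IsMinimal T K := by
  refine ⟨fun k => Metric.dense_iff.2 fun k' r hr => ?_⟩
  obtain ⟨s, hs⟩ := hιd.exists_dist_lt k (show 0 < r / 3 by positivity)
  obtain ⟨s', hs'⟩ := hιd.exists_dist_lt k' (show 0 < r / 3 by positivity)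
  obtain ⟨_, ht, ⟨t, rfl⟩⟩ := Metric.dense_iff.1 (MulAction.dense_orbit T s) s' (r / 3)
    (by positivity)
  refine ⟨t • k, ?_, ⟨t, rfl⟩⟩
  rw [Metric.mem_ball] at ht ⊢
  have h1 : dist (t • k) (ι (t • s)) < r / 3 := by rw [hιT, dist_smul]; exact hs
  have h2 : dist (ι (t • s)) (ι s') < r / 3 := by rw [hι.dist_eq]; exact ht
  have h3 := dist_triangle4 (t • k) (ι (t • s)) (ι s') k'
  rw [dist_comm (ι s') k'] at h3
  linarith

theorem smulInvariantMeasure_comap_subtype {T E : Type*} [Group T] [MeasurableSpace E]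
    [MulAction T E] (m : Measure E) [SMulInvariantMeasure T E m] [MeasurableConstSMul T E]
    (S : SubMulAction T E) (hS : MeasurableSet (S : Set E)) :
    SMulInvariantMeasure T S (m.comap ((↑) : S → E)) where
  measure_preimage_smul t s _ := by
    have he : MeasurableEmbedding ((↑) : S → E) := MeasurableEmbedding.subtype_coe hS
    have himage : ((↑) : S → E) '' ((t • ·) ⁻¹' s) = (t • ·) ⁻¹' (((↑) : S → E) '' s) := by
      ext x
      constructor
      · rintro ⟨y, hy, rfl⟩
        exact ⟨t • y, hy, rfl⟩
      · rintro ⟨y, hy, hyx⟩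
        have hx : x ∈ S := by
          have := S.smul_mem t⁻¹ y.2
          rw [hyx] at this
          simpa using this
        have hty : t • (⟨x, hx⟩ : S) = y := Subtype.ext hyx.symm
        exact ⟨⟨x, hx⟩, Set.mem_preimage.2 (hty ▸ hy), rfl⟩
    rw [he.comap_apply, he.comap_apply, himage, measure_preimage_smul]

variable {T : Type v} [Group T] {E X : Type u} [MetricSpace E] [SecondCountableTopology E]
  [MeasurableSpace E] [BorelSpace E] [MulAction T E] [IsIsometricSMul T E] [TopologicalSpace X]
  [MeasurableSpace X] [BorelSpace X] [MulAction T X] [ContinuousConstSMul T X] [CompactSpace X]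
  [T2Space X] {j : E ≃ᵐ X}

/-- The case of a minimal system: `K` is the completion of the support, in the metric topology, of
an ergodic measure. -/
theorem minimal_system_of_amenable [Nonempty X] [MulAction.IsMinimal T X] (hT : IsAmenable T)
    (hj : Continuous j) (hjT : ∀ (t : T) (e : E), j (t • e) = t • j e) :
    IsAlmostAutomorphic T X ∧ IsPointDistal T X ∧
      IsIsomorphicExtensionOfMaximalEquicontinuousFactor T X := by
  have hX2 : SecondCountableTopology X :=
    secondCountableTopology_of_continuous_surjective hj j.surjective
  have hXp : PolishSpace X := by
    let := TopologicalSpace.metrizableSpaceMetric X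
    infer_instance
  have hEs : StandardBorelSpace E := standardBorelSpace_of_measurableEquiv j
  obtain ⟨μ, hμ, hμT⟩ := hT.exists_ergodic_measure (X := X)
  have hm := ergodicSMul_map_symm hjT μ
  have hpm : IsProbabilityMeasure (μ.map j.symm) :=
    Measure.isProbabilityMeasure_map j.symm.measurable.aemeasurable
  set m := μ.map j.symm with hmdef
  let S : SubMulAction T E := ⟨m.support, fun t x hx => smul_mem_support t hx⟩
  have hSc : IsClosed (S : Set E) := Measure.isClosed_support
  have hSm : MeasurableSet (S : Set E) := hSc.measurableSet
  have hScl : ∀ s : S, closure (MulAction.orbit T (s : E)) = S := fun s =>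
    closure_orbit_eq_support s.2
  obtain ⟨e₀, he₀⟩ : m.support.Nonempty := Measure.nonempty_support (IsProbabilityMeasure.ne_zero m)
  have hSne : Nonempty S := ⟨⟨e₀, he₀⟩⟩
  have hStb : TotallyBounded (S : Set E) := by
    rw [← hScl ⟨e₀, he₀⟩]
    exact (totallyBounded_orbit_of_mem_support (T := T) he₀).closure
  have hSiso := isIsometricSMul_subMulAction S
  have hSmin : MulAction.IsMinimal T S := by
    refine ⟨fun s => ?_⟩
    intro s'
    rw [closure_subtype]
    have h1 : ((↑) : S → E) '' MulAction.orbit T s = MulAction.orbit T (s : E) := by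
      ext x
      constructor
      · rintro ⟨_, ⟨t, rfl⟩, rfl⟩
        exact ⟨t, rfl⟩
      · rintro ⟨t, rfl⟩
        exact ⟨t • s, ⟨t, rfl⟩, rfl⟩
    rw [h1, hScl s]
    exact s'.2
  have hSs : StandardBorelSpace S := hSm.standardBorel
  have hSb : BorelSpace S := Subtype.borelSpace (S : Set E)
  have hmS : SMulInvariantMeasure T S (m.comap ((↑) : S → E)) :=
    smulInvariantMeasure_comap_subtype m S hSm
  have hmSp : IsProbabilityMeasure (m.comap ((↑) : S → E)) := by
    refine ⟨?_⟩
    have hall : (S : Set E) ∈ ae m := Measure.support_mem_ae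
    refine ((MeasurableEmbedding.subtype_coe hSm).comap_apply m _).trans ?_
    rw [Set.image_univ, Subtype.range_coe]
    exact (prob_compl_eq_zero_iff hSm).1 hall
  have hSu : UniformContinuousConstSMul T S := ⟨fun t => (isometry_smul S t).uniformContinuous⟩
  let K := UniformSpace.Completion S
  have hKiso : IsIsometricSMul T K := isIsometricSMul_completion
  have hKc : CompactSpace K := by
    have hStb' : TotallyBounded (Set.univ : Set S) := by
      rw [← totallyBounded_image_iff (isUniformInducing_val (S : Set E))]
      simpa using hStb
    have h1 := (hStb'.image (UniformSpace.Completion.uniformContinuous_coe S)).closure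
    rw [Set.image_univ, UniformSpace.Completion.denseRange_coe.closure_eq] at h1
    exact ⟨h1.isCompact_of_isClosed isClosed_univ⟩
  borelize K
  have hι : Isometry ((↑) : S → K) := UniformSpace.Completion.coe_isometry
  have hιT : ∀ (t : T) (s : S), ((t • s : S) : K) = t • (s : K) := fun t s =>
    UniformSpace.Completion.coe_smul t s
  have hKmin : MulAction.IsMinimal T K :=
    isMinimal_of_denseRange_isometry hι UniformSpace.Completion.denseRange_coe hιT
  set h : S → X := fun s => j s with hh
  have hhc : Continuous h := hj.comp continuous_subtype_val
  have hhi : Function.Injective h := j.injective.comp Subtype.val_injective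
  have hhT : ∀ (t : T) (s : S), h (t • s) = t • h s := fun t s => hjT t s
  obtain ⟨π, hπ, hπh, hπi⟩ :=
    exists_isometric_factor (m.comap ((↑) : S → E)) hT hι hιT hhc hhi hhT
  refine ⟨⟨inferInstance, j e₀, isAlmostAutomorphicPoint_of_totallyBounded hj hjT
    (totallyBounded_orbit_of_mem_support he₀)⟩, ⟨h ⟨e₀, he₀⟩, MulAction.dense_orbit T _, ?_⟩, ?_⟩
  · intro y hy
    refine hπi y ⟨e₀, he₀⟩ ?_
    rw [← hπh]
    exact ((hy.map hπ).eq_of_isEquicontinuousSystem isEquicontinuousSystem_of_isometric).symm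
  · exact ⟨K, inferInstance, inferInstance, inferInstance, inferInstance, inferInstance,
      inferInstance, inferInstance, π, isMaximalEquicontinuousFactor_of_factor hπ hπi,
      isIsomorphicExtension_of_factor (m.comap ((↑) : S → E)) hι hιT hhc hhT hπ hπh hπi⟩

/-- The metric model of a system restricts to invariant subsets. -/
theorem minimalSet_of_amenable (hT : IsAmenable T) (hj : Continuous j)
    (hjT : ∀ (t : T) (e : E), j (t • e) = t • j e) (M : SubMulAction T X)
    (hM : IsMinimalSet T (M : Set X)) :
    IsAlmostAutomorphic T M ∧ IsPointDistal T M ∧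
      IsIsomorphicExtensionOfMaximalEquicontinuousFactor T M := by
  let P : SubMulAction T E := ⟨j ⁻¹' M, fun t e he => by
    rw [Set.mem_preimage, hjT]
    exact M.smul_mem t he⟩
  have hPiso := isIsometricSMul_subMulAction P
  have hPb : BorelSpace P := Subtype.borelSpace (P : Set E)
  have hPs : SecondCountableTopology P :=
    TopologicalSpace.Subtype.secondCountableTopology (P : Set E)
  have hMb : BorelSpace M := Subtype.borelSpace (M : Set X)
  have hMc : CompactSpace M := isCompact_iff_compactSpace.1 hM.isClosed.isCompact
  have hMs : ContinuousConstSMul T M := ⟨fun t =>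
    ((continuous_const_smul t).comp continuous_subtype_val).subtype_mk _⟩
  have hMne : Nonempty M := hM.nonempty.to_subtype
  have hMmin : MulAction.IsMinimal T M := by
    refine ⟨fun x y => ?_⟩
    rw [closure_subtype]
    have h1 : ((↑) : M → X) '' MulAction.orbit T x = MulAction.orbit T (x : X) := by
      ext z
      constructor
      · rintro ⟨_, ⟨t, rfl⟩, rfl⟩
        exact ⟨t, rfl⟩
      · rintro ⟨t, rfl⟩
        exact ⟨t • x, ⟨t, rfl⟩, rfl⟩
    rw [h1]
    exact hM.dense_orbit x x.2 y.2
  let i : P ≃ᵐ M :=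
    { toEquiv := j.toEquiv.subtypeEquiv fun _ => Iff.rfl
      measurable_toFun := (j.measurable.comp measurable_subtype_coe).subtype_mk
      measurable_invFun := (j.symm.measurable.comp measurable_subtype_coe).subtype_mk }
  have hi : Continuous i := (hj.comp continuous_subtype_val).subtype_mk _
  exact minimal_system_of_amenable (j := i) hT hi fun t e => Subtype.ext (hjT t e)

end Minimal

end VeechSystem
end

open VeechSystem in
theorem mainTheorem7 {T : Type*} {X : Type*} [Group T] [Countable T]
    [TopologicalSpace X] [CompactSpace X] [T2Space X] [MeasurableSpace X] [BorelSpace X]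
    [MulAction T X] [ContinuousConstSMul T X] (hX : IsVeechSystem T X) :
    (∀ (μ : Measure X) [IsProbabilityMeasure μ] [ErgodicSMul T X μ],
      IsMinimalSet T μ.support) ∧
    (IsAmenable T →
      (∀ M : SubMulAction T X, IsMinimalSet T (M : Set X) →
        IsAlmostAutomorphic T M ∧ IsPointDistal T M ∧
          IsIsomorphicExtensionOfMaximalEquicontinuousFactor T M) ∧
      (∀ (μ : Measure X) [IsProbabilityMeasure μ] [ErgodicSMul T X μ],
        HasDiscreteSpectrum T X μ)) := by
  obtain ⟨E, _, _, _, _, _, _, j, hj, hjT⟩ := hX.exists_metric_model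
  refine ⟨fun μ _ _ => isMinimalSet_support hj hjT μ, fun hT =>
    ⟨fun M hM => minimalSet_of_amenable hT hj hjT M hM, fun μ _ _ => hX.hasDiscreteSpectrum μ⟩⟩
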